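/- Let $d\ge 2$, $\mathcal A=\{1,\dots,d\}$, and let $\boldsymbol\sigma=(\sigma_n)_{n\in\mathbb Z}$ be a sequence of unimodular substitutions over $\mathcal A$, i.e., nonerasing endomorphisms of the free monoid $\mathcal A^*$ whose incidence matrices $M_{\sigma_n}=(|\sigma_n(b)|_a)_{a,b\in\mathcal A}$ have determinant $\pm1$. Write $\sigma_{[m,n)}=\sigma_m\sigma_{m+1}\cdots\sigma_{n-1}$ and $M_{[m,n)}=M_{\sigma_m}\cdots M_{\sigma_{n-1}}$ for $m\le n$. Assume that $\boldsymbol\sigma$ is primitive (for each $m\in\mathbb Z$ there is $n>m$ such that all entries of $M_{[m,n)}$ are positive) and that it admits a generalized right eigenvector $\mathbf u$, i.e., a vector $\mathbf u\in\mathbb R_{\ge0}^d\setminus\{\mathbf 0\}$ with $\bigcap_{k\in\mathbb N}M_{[0,k)}\mathbb R_{\ge0}^d=\mathbb R_{\ge0}\mathbf u$. For $n\in\mathbb Z$ let $\mathbf u_n=M_{[0,n)}^{-1}\mathbf u$ if $n\ge0$ and $\mathbf u_n=M_{[n,0)}\mathbf u$ if $n<0$. Let $X_{\boldsymbol\sigma}^{(n)}$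 be the set of all $\omega\in\mathcal A^{\mathbb Z}$ each of whose factors is a factor of $\sigma_{[n,m)}(a)$ for some $a\in\mathcal A$, $m>n$, and let $\Sigma$ be the shift map on it. Let $\boldsymbol\ell(p)=(|p|_1,\dots,|p|_d)$ be the abelianization of a word $p$, let $\mathbf 1=(1,\dots,1)$, let $\pi(\mathbf x)=\mathbf x-\frac{\langle\mathbf x,\mathbf 1\rangle}{\langle\mathbf u_n,\mathbf 1\rangle}\mathbf u_n$ be the projection along $\mathbf u_n$ onto $\mathbf 1^\perp$, and for $a\in\mathcal A$ let $$\mathcal R_n^{\mathbf 1}(a)=\overline{\{\pi\boldsymbol\ell(p)\,:\,pa\text{ is a prefix of }\sigma_{[n,m)}(b)\text{ for infinitely many }m\ge n,\ b\in\mathcal A\}}.$$ Fix $n\in\mathbb Z$ and suppose that the collection $\mathcal C_n^{\mathbf 1}$ of the sets $\pi\mathbf x+\mathcal R_n^{\mathbf 1}(a)$, indexed by the pairs $(\mathbf x,a)\in\mathbb Z^d\times\mathcal A$ with $0\le\langle\mathbf 1,\mathbf x\rangle<\langle\mathbf 1,\mathbf e_a\rangle$ (equivalently, $\mathbf x\in\mathbb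 Z^d\cap\mathbf 1^\perp$), forms a tiling of $\mathbf 1^\perp$: these closed sets cover $\mathbf 1^\perp$, and the intersection of the sets belonging to any two distinct pairs has $(d-1)$-dimensional Lebesgue measure zero. Then $(X_{\boldsymbol\sigma}^{(n)},\Sigma)$ is uniquely ergodic, i.e., it has exactly one shift-invariant Borel probability measure $\mu$. There is $(\alpha_1,\dots,\alpha_{d-1})\in\mathbb R^{d-1}$ with $(\alpha_1,\dots,\alpha_{d-1},1-\sum_{i=1}^{d-1}\alpha_i)\in\mathbb R_{\ge0}\mathbf u_n$; the rotation $\mathbf z\mapsto\mathbf z+(\alpha_1,\dots,\alpha_{d-1})$ of $\mathbb T^{d-1}=(\mathbb R/\mathbb Z)^{d-1}$ is minimal, and $(X_{\boldsymbol\sigma}^{(n)},\Sigma,\mu)$ is measurably conjugate to this rotation with Lebesgue measure, i.e., there is a bimeasurable, measure preserving bijection between measurable subsets of measure $1$ that intertwines the two maps. Moreover, $(X_{\boldsymbol\sigma}^{(n)},\Sigma)$ has pure discrete spectrum: it is minimal and uniquely ergodic, and the eigenfunctions of the Koopman operator $f\mapsto f\circ\Sigma$ span a dense subspace of $L^2(\mu)$.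 -/

import Mathlib

open MeasureTheory Set

noncomputable section

namespace SAdic

/-! ### Products along a bi-infinite sequence, substitutions, incidence matrices -/

/-- `segProd s m n = s m * s (m + 1) * ⋯ * s (n - 1)` for `m ≤ n` (and `1` for `n ≤ m`).
It is used for matrices and for endomorphisms of the free monoid (product = composition). -/
def segProd {G : Type*} [Monoid G] (s : ℤ → G) (m n : ℤ) : G :=
  ((List.range (n - m).toNat).map fun k => s (m + k)).prod

/-- The incidence matrix of an endomorphism of the free monoid: the entry `(a, b)` is the number
of occurrences of the letter `a` in the image of the letter `b`. -/
def incidenceMatrix {d : ℕ} (τ : Monoid.End (FreeMonoid (Fin d))) : Matrix (Fin d) (Fin d) ℕ :=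
  fun a b => (FreeMonoid.toList (τ (FreeMonoid.of b))).count a

/-- The set of unimodular substitutions over an alphabet with `d` letters: nonerasing
endomorphisms of the free monoid whose incidence matrix has determinant `±1`. -/
def unimodularSubstitutions (d : ℕ) : Set (Monoid.End (FreeMonoid (Fin d))) :=
  {τ | (∀ a : Fin d, 1 ≤ (τ (FreeMonoid.of a)).length) ∧
    |((incidenceMatrix τ).map (Nat.cast : ℕ → ℤ)).det| = 1}

/-- The sequence of incidence matrices, as real matrices. -/
def incidenceSeq {d : ℕ} (σ : ℤ → Monoid.End (FreeMonoid (Fin d))) :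
    ℤ → Matrix (Fin d) (Fin d) ℝ :=
  fun k => (incidenceMatrix (σ k)).map (Nat.cast : ℕ → ℝ)

/-! ### Primitivity and generalized right eigenvectors -/

/-- Primitivity (in the future): for each `m` there is `n > m` such that
`M_m M_{m+1} ⋯ M_{n-1}` is a positive matrix. -/
def IsPrimitiveSeq {d : ℕ} (M : ℤ → Matrix (Fin d) (Fin d) ℝ) : Prop :=
  ∀ m : ℤ, ∃ n : ℤ, m < n ∧ ∀ i j, 0 < segProd M m n i j

/-- The ray of nonnegative multiples of `u`. -/
def ray {d : ℕ} (u : Fin d → ℝ) : Set (Fin d → ℝ) :=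
  {x | ∃ c : ℝ, 0 ≤ c ∧ x = c • u}

/-- `u` is a generalized right eigenvector of `M`: it is nonnegative, nonzero, and the
intersection of the cones `M_0 ⋯ M_{k-1} ℝ_{≥0}^d`, `k ∈ ℕ`, is the ray spanned by `u`. -/
def IsGeneralizedRightEigenvector {d : ℕ} (M : ℤ → Matrix (Fin d) (Fin d) ℝ)
    (u : Fin d → ℝ) : Prop :=
  (∀ i, 0 ≤ u i) ∧ u ≠ 0 ∧
    (⋂ k : ℕ, (fun x => (segProd M 0 (k : ℤ)).mulVec x) '' {x : Fin d → ℝ | ∀ i, 0 ≤ x i}) =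
      ray u

/-- The vector `u_n` obtained from `u = u_0`, namely `(M_0 ⋯ M_{n-1})⁻¹ u` for `n ≥ 0`
and `M_n ⋯ M_{-1} u` for `n < 0`. -/
def levelVector {d : ℕ} (M : ℤ → Matrix (Fin d) (Fin d) ℝ) (u : Fin d → ℝ) (n : ℤ) :
    Fin d → ℝ :=
  if 0 ≤ n then ((segProd M 0 n)⁻¹).mulVec u else (segProd M n 0).mulVec u

/-! ### The S-adic shift -/

/-- The language of level `n`: all factors of the words `σ_{[n,m)}(a)`, `m > n`, `a` a letter. -/
def language {d : ℕ} (σ : ℤ → Monoid.End (FreeMonoid (Fin d))) (n : ℤ) : Set (List (Fin d)) :=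
  {w | ∃ (a : Fin d) (m : ℤ), n < m ∧
    w <:+: FreeMonoid.toList (segProd σ n m (FreeMonoid.of a))}

/-- The factor `ω_i ω_{i+1} ⋯ ω_{i+k-1}` of a bi-infinite sequence. -/
def factor {d : ℕ} (ω : ℤ → Fin d) (i : ℤ) (k : ℕ) : List (Fin d) :=
  (List.range k).map fun j => ω (i + j)

/-- The S-adic shift of level `n`: the bi-infinite sequences all of whose factors belong to the
language of level `n`. As a subtype of `ℤ → Fin d` it carries the product topology and the
corresponding Borel sets. -/
def shiftSpace {d : ℕ} (σ : ℤ → Monoid.End (FreeMonoid (Fin d))) (n : ℤ) : Set (ℤ → Fin d) :=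
  {ω | ∀ (i : ℤ) (k : ℕ), factor ω i k ∈ language σ n}

theorem shift_mem {d : ℕ} {σ : ℤ → Monoid.End (FreeMonoid (Fin d))} {n : ℤ} {ω : ℤ → Fin d}
    (h : ω ∈ shiftSpace σ n) : (fun k => ω (k + 1)) ∈ shiftSpace σ n := by
  intro i k
  have e : factor (fun k => ω (k + 1)) i k = factor ω (i + 1) k := by
    simp only [factor]
    congr 1
    funext j
    congr 1
    ring
  rw [e]
  exact h (i + 1) k

/-- The shift map `(ω_k) ↦ (ω_{k+1})` on the S-adic shift of level `n`. -/
def shiftMap {d : ℕ} (σ : ℤ → Monoid.End (FreeMonoid (Fin d))) (n : ℤ) :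
    shiftSpace σ n → shiftSpace σ n :=
  fun ω => ⟨fun k => ω.1 (k + 1), shift_mem ω.2⟩

/-! ### Notions from dynamics -/

/-- Minimality: no closed invariant subset except the empty set and the whole space. -/
def IsMinimalMap {X : Type*} [TopologicalSpace X] (T : X → X) : Prop :=
  ∀ S : Set X, IsClosed S → MapsTo T S S → S = ∅ ∨ S = univ

/-- `μ` is a `T`-invariant probability measure, and the only one. -/
structure IsUniqueInvariantProbability {X : Type*} [MeasurableSpace X] (T : X → X)
    (μ : Measure X) : Prop where
  isProbabilityMeasure : IsProbabilityMeasure μ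
  measurePreserving : MeasurePreserving T μ μ
  unique : ∀ ν : Measure X, IsProbabilityMeasure ν → MeasurePreserving T ν ν → ν = μ

/-- The Koopman operator `f ↦ f ∘ T` on `L²(μ)`. -/
def koopman {X : Type*} [MeasurableSpace X] {μ : Measure X} {T : X → X}
    (hT : MeasurePreserving T μ μ) : Lp ℂ 2 μ →ₗ[ℂ] Lp ℂ 2 μ :=
  (Lp.compMeasurePreservingₗᵢ ℂ T hT).toLinearMap

/-- Pure discrete spectrum: `T` is minimal, it has a unique invariant probability measure `μ`,
and the eigenfunctions of the Koopman operator span a dense subspace of `L²(μ)`. -/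
def HasPureDiscreteSpectrum {X : Type*} [TopologicalSpace X] [MeasurableSpace X]
    (T : X → X) : Prop :=
  IsMinimalMap T ∧ ∃ (μ : Measure X) (h : IsUniqueInvariantProbability T μ),
    (⨆ c : ℂ, Module.End.eigenspace (koopman h.measurePreserving) c).topologicalClosure = ⊤

/-- Measurable conjugacy of `(X, T, μ)` and `(Y, S, ν)`: a bimeasurable, measure preserving
bijection between measurable subsets of measure `1` that intertwines `T` and `S`. -/
def MeasurablyConjugate {X Y : Type*} [MeasurableSpace X] [MeasurableSpace Y]
    (T : X → X) (μ : Measure X) (S : Y → Y) (ν : Measure Y) : Prop :=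
  ∃ (X₁ : Set X) (Y₁ : Set Y), MeasurableSet X₁ ∧ MeasurableSet Y₁ ∧ μ X₁ = 1 ∧ ν Y₁ = 1 ∧
    ∃ (hT : MapsTo T X₁ X₁) (g : X₁ ≃ᵐ Y₁),
      (∀ x : X₁, (g ⟨T x, hT x.2⟩ : Y) = S (g x)) ∧
      ∀ U : Set X₁, MeasurableSet U →
        ν ((fun y : Y₁ => (y : Y)) '' (g '' U)) = μ ((fun x : X₁ => (x : X)) '' U)

/-- The rotation `z ↦ z + α` of the torus `(ℝ/ℤ)^k`. -/
def torusRotation {k : ℕ} (α : Fin k → ℝ) : (Fin k → UnitAddCircle) → (Fin k → UnitAddCircle) :=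
  fun z i => z i + (α i : UnitAddCircle)

/-- The vector `(α_1, …, α_{d-1}, 1 - ∑ α_i)`. -/
def completedVector {d : ℕ} (α : Fin (d - 1) → ℝ) : Fin d → ℝ :=
  fun j => if h : (j : ℕ) < d - 1 then α ⟨j, h⟩ else 1 - ∑ i, α i

/-! ### Rauzy fractals and tilings of hyperplanes -/

/-- The abelianization of a finite word, as a real vector. -/
def abelianization {d : ℕ} (p : List (Fin d)) : Fin d → ℝ := fun a => (p.count a : ℝ)

/-- The hyperplane `w^⊥` (with respect to the standard scalar product). -/
def hyperplane {d : ℕ} (w : Fin d → ℝ) : Submodule ℝ (Fin d → ℝ) where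
  carrier := {x | x ⬝ᵥ w = 0}
  add_mem' := by
    intro x y hx hy
    simp only [mem_ofPred_eq] at hx hy ⊢
    rw [add_dotProduct, hx, hy, add_zero]
  zero_mem' := by simp
  smul_mem' := by
    intro c x hx
    simp only [mem_ofPred_eq] at hx ⊢
    rw [smul_dotProduct, hx, smul_zero]

/-- The projection along `u` onto `w^⊥` (for `⟨u, w⟩ ≠ 0`). -/
def proj {d : ℕ} (u w x : Fin d → ℝ) : Fin d → ℝ := x - ((x ⬝ᵥ w) / (u ⬝ᵥ w)) • u

/-- The subtile of level `n` of the letter `a`, in the hyperplane `w^⊥`, projected along `v`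
(which is `u_n` in the applications): the closure of the set of projections of the
abelianizations of the words `p` such that `p a` is a prefix of `σ_{[n,m)}(b)` for infinitely
many `m ≥ n`, `b` a letter. -/
def subtile {d : ℕ} (σ : ℤ → Monoid.End (FreeMonoid (Fin d))) (v w : Fin d → ℝ) (n : ℤ)
    (a : Fin d) : Set (Fin d → ℝ) :=
  closure {x | ∃ p : List (Fin d), x = proj v w (abelianization p) ∧
    {m : ℤ | n ≤ m ∧ ∃ b : Fin d,
      (p ++ [a]) <+: FreeMonoid.toList (segProd σ n m (FreeMonoid.of b))}.Infinite}

/-- The discrete hyperplane: the pairs `(x, a) ∈ ℤ^d × 𝒜` with `0 ≤ ⟨w, x⟩ < ⟨w, e_a⟩`. -/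
def discreteHyperplane {d : ℕ} (w : Fin d → ℝ) : Set ((Fin d → ℤ) × Fin d) :=
  {q | 0 ≤ w ⬝ᵥ (fun i => (q.1 i : ℝ)) ∧ w ⬝ᵥ (fun i => (q.1 i : ℝ)) < w q.2}

/-- The collection of tiles `π x + R(a)`, where `(x, a)` runs through the discrete hyperplane. -/
def tile {d : ℕ} (σ : ℤ → Monoid.End (FreeMonoid (Fin d))) (v w : Fin d → ℝ) (n : ℤ)
    (q : discreteHyperplane w) : Set (Fin d → ℝ) :=
  (fun z => proj v w (fun i => (q.1.1 i : ℝ)) + z) '' subtile σ v w n q.1.2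

/-- The family `t` of subsets of `w^⊥` is a tiling of `w^⊥`: the tiles are closed, cover `w^⊥`,
and two tiles with different indices have an intersection of Lebesgue measure zero in `w^⊥`
(Lebesgue measure on `w^⊥` is the Haar measure; its normalization does not affect null sets). -/
structure IsTilingOfHyperplane {d : ℕ} {ι : Type*} (w : Fin d → ℝ)
    (t : ι → Set (Fin d → ℝ)) : Prop where
  isClosed : ∀ i, IsClosed (t i)
  covers : (⋃ i, t i) = (hyperplane w : Set (Fin d → ℝ))
  disjoint_in_measure : ∀ i j, i ≠ j →
    (Measure.addHaar : Measure (hyperplane w))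
      ((fun z : hyperplane w => (z : Fin d → ℝ)) ⁻¹' (t i ∩ t j)) = 0

end SAdic

end

open SAdic

/-!
The proof turns the tiling of the hyperplane into a coding of a torus rotation and never needs the
subtiles to be bounded.

Dropping the last coordinate (and changing the sign) identifies `𝟏^⊥` with `ℝ^{d-1}` and its
lattice of integer points with `ℤ^{d-1}`.  The subtiles `R(a)` become closed sets whose integer
translates cover `ℝ^{d-1}` with null overlaps, so almost every point `t` of the torus, together
with its whole orbit under the rotation by the letter frequencies `α`, has exactly one lift in
exactly one `R(a)`; reading off the letters along the orbit gives a bi-infinite word, the coding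
of `t`.  A subtile is the closure of projected prefixes, and a prefix before `a` is also a prefix
before some longer word beginning with `a`; hence codings lie in the shift, and the lift moves by
the projection of the letter read (`IsExchangeTiling.code_spec`).  The rotation is minimal because
the projected prefixes are points of a single orbit modulo `ℤ^{d-1}` and the tiles cover.

The coding is injective (`IsExchangeTiling.code_injOn`).  If two points have the same coding, their
lifts always differ by the same vector `c`.  The union `R` of the `R(a)` has an interior `U ≠ ∅` by
Baire, and density of orbits gives `U + c ⊆ U`; since `U` embeds into the torus, recurrence of the
rotation by `c` forces `c = 0`.  By the Lusin–Souslin theorem the coding is a Borel isomorphism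
onto its image, which transports Lebesgue measure and the characters of the torus to the shift
(`exists_conjugate_measure`): this gives the conjugacy and the density of the eigenfunctions.

Unique ergodicity does not use the tiling.  The generalized right eigenvector makes letter
frequencies uniform (`exists_letter_frequency_bound`).  Desubstituting a long word into blocks
`σ_{[n,m)}(b)`, whose numbers are determined by the letter counts since the incidence matrix is
invertible, makes all word frequencies uniform (`exists_mean_of_quasiAdditive`), and an invariant
measure must assign these frequencies to cylinders.  Minimality of the shift is primitivity.
-/

/-! ### Substitutions acting on words -/

namespace SAdic

variable {d : ℕ}

/-- The action of an endomorphism of the free monoid on words, as lists. -/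
def applyWord (τ : Monoid.End (FreeMonoid (Fin d))) (w : List (Fin d)) : List (Fin d) :=
  FreeMonoid.toList (τ (FreeMonoid.ofList w))

theorem applyWord_singleton (τ : Monoid.End (FreeMonoid (Fin d))) (a : Fin d) :
    applyWord τ [a] = FreeMonoid.toList (τ (FreeMonoid.of a)) := rfl

theorem applyWord_nil (τ : Monoid.End (FreeMonoid (Fin d))) : applyWord τ [] = [] := by
  simp [applyWord]

theorem applyWord_append (τ : Monoid.End (FreeMonoid (Fin d))) (x y : List (Fin d)) :
    applyWord τ (x ++ y) = applyWord τ x ++ applyWord τ y := by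
  simp only [applyWord, FreeMonoid.ofList_append, map_mul, FreeMonoid.toList_mul]

theorem applyWord_cons (τ : Monoid.End (FreeMonoid (Fin d))) (a : Fin d) (y : List (Fin d)) :
    applyWord τ (a :: y) = applyWord τ [a] ++ applyWord τ y :=
  applyWord_append τ [a] y

theorem applyWord_mul (τ τ' : Monoid.End (FreeMonoid (Fin d))) (w : List (Fin d)) :
    applyWord (τ * τ') w = applyWord τ (applyWord τ' w) := rfl

theorem applyWord_one (w : List (Fin d)) :
    applyWord (1 : Monoid.End (FreeMonoid (Fin d))) w = w := rfl

theorem length_eq_sum_count (w : List (Fin d)) : w.length = ∑ a, w.count a := by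
  induction w with
  | nil => simp
  | cons b w ih => simp [List.count_cons, Finset.sum_add_distrib, ih]

/-! ### Abelianization and incidence matrices -/

theorem abelianization_nil : abelianization ([] : List (Fin d)) = 0 := by
  ext a; simp [abelianization]

theorem abelianization_append (x y : List (Fin d)) :
    abelianization (x ++ y) = abelianization x + abelianization y := by
  ext a; simp [abelianization]

theorem abelianization_cons (b : Fin d) (y : List (Fin d)) :
    abelianization (b :: y) = abelianization [b] + abelianization y :=
  abelianization_append [b] y

theorem abelianization_singleton (b : Fin d) : abelianization [b] = Pi.single b (1 : ℝ) := by
  ext a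
  by_cases h : b = a
  · subst h; simp [abelianization]
  · simp [abelianization, h, Ne.symm h]

theorem sum_abelianization (w : List (Fin d)) : ∑ a, abelianization w a = w.length := by
  rw [length_eq_sum_count]; simp [abelianization]

theorem abelianization_nonneg (w : List (Fin d)) (a : Fin d) : 0 ≤ abelianization w a := by
  simp [abelianization]

/-- The incidence matrix with real entries. -/
def realIncidence (τ : Monoid.End (FreeMonoid (Fin d))) : Matrix (Fin d) (Fin d) ℝ :=
  (incidenceMatrix τ).map (Nat.cast : ℕ → ℝ)

theorem realIncidence_apply (τ : Monoid.End (FreeMonoid (Fin d))) (a b : Fin d) :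
    realIncidence τ a b = abelianization (applyWord τ [b]) a := rfl

theorem abelianization_applyWord (τ : Monoid.End (FreeMonoid (Fin d))) (w : List (Fin d)) :
    abelianization (applyWord τ w) = (realIncidence τ).mulVec (abelianization w) := by
  induction w with
  | nil => simp [applyWord_nil, abelianization_nil]
  | cons b w ih =>
    rw [applyWord_cons, abelianization_append, ih, abelianization_cons b w, Matrix.mulVec_add,
      abelianization_singleton]
    congr 1
    ext a
    simp [realIncidence_apply]

theorem realIncidence_one : realIncidence (1 : Monoid.End (FreeMonoid (Fin d))) = 1 := by
  ext a b
  rw [realIncidence_apply, applyWord_one, abelianization_singleton]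
  simp [Matrix.one_apply, Pi.single_apply]

theorem realIncidence_mul (τ τ' : Monoid.End (FreeMonoid (Fin d))) :
    realIncidence (τ * τ') = realIncidence τ * realIncidence τ' := by
  ext a b
  rw [realIncidence_apply, applyWord_mul, abelianization_applyWord]
  rfl

/-- In the definition of `segProd` the list of naturals is first cast to a list of integers;
here the cast is moved inside. -/
theorem segProd_eq {G : Type*} [Monoid G] (s : ℤ → G) (m n : ℤ) :
    segProd s m n = ((List.range (n - m).toNat).map fun k : ℕ => s (m + (k : ℤ))).prod := by
  simp [segProd, ← List.map_eq_flatMap, Function.comp_def]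

theorem factor_eq (ω : ℤ → Fin d) (i : ℤ) (k : ℕ) :
    factor ω i k = (List.range k).map fun j : ℕ => ω (i + (j : ℤ)) := by
  simp [factor, ← List.map_eq_flatMap]

theorem segProd_self {G : Type*} [Monoid G] (s : ℤ → G) (m : ℤ) : segProd s m m = 1 := by
  simp [segProd_eq]

theorem segProd_mul {G : Type*} [Monoid G] (s : ℤ → G) {k m n : ℤ} (h : k ≤ m) (h' : m ≤ n) :
    segProd s k m * segProd s m n = segProd s k n := by
  obtain ⟨i, rfl⟩ := Int.le.dest h
  obtain ⟨j, rfl⟩ := Int.le.dest h'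
  have e : (k + i + j - k).toNat = i + j := by omega
  have e1 : (k + i - k).toNat = i := by omega
  have e2 : (k + i + j - (k + i)).toNat = j := by omega
  simp only [segProd_eq, e, e1, e2, List.range_add, List.map_append, List.prod_append, List.map_map]
  congr 3
  funext x
  simp [add_assoc]

theorem segProd_incidenceSeq (σ : ℤ → Monoid.End (FreeMonoid (Fin d))) (m n : ℤ) :
    segProd (incidenceSeq σ) m n = realIncidence (segProd σ m n) := by
  let f : Monoid.End (FreeMonoid (Fin d)) →* Matrix (Fin d) (Fin d) ℝ :=
    ⟨⟨realIncidence, realIncidence_one⟩, realIncidence_mul⟩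
  change _ = f _
  rw [segProd_eq, segProd_eq, map_list_prod, List.map_map]
  rfl

theorem isUnit_det_segProd {σ : ℤ → Monoid.End (FreeMonoid (Fin d))}
    (hσ : ∀ k, σ k ∈ unimodularSubstitutions d) (m n : ℤ) :
    IsUnit (segProd (incidenceSeq σ) m n).det := by
  rw [segProd_eq, ← Matrix.isUnit_iff_isUnit_det]
  refine Submonoid.list_prod_mem (IsUnit.submonoid _) fun x hx => ?_
  obtain ⟨k, -, rfl⟩ := List.mem_map.1 hx
  rw [IsUnit.mem_submonoid_iff, Matrix.isUnit_iff_isUnit_det, isUnit_iff_ne_zero]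
  intro h0
  have h := (hσ (m + k)).2
  have e : (incidenceSeq σ (m + k)) =
      ((incidenceMatrix (σ (m + k))).map (Nat.cast : ℕ → ℤ)).map (Int.castRingHom ℝ) := by
    ext a b; simp [incidenceSeq]
  have h1 : (((incidenceMatrix (σ (m + k))).map (Nat.cast : ℕ → ℤ)).det : ℝ) = 0 := by
    rw [← h0, e]
    exact RingHom.map_det (Int.castRingHom ℝ) _
  have h2 : ((incidenceMatrix (σ (m + k))).map (Nat.cast : ℕ → ℤ)).det = 0 := by exact_mod_cast h1
  rw [h2] at h
  simp at h

/-! ### Growth of the lengths of images of letters -/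

theorem le_length_applyWord {τ : Monoid.End (FreeMonoid (Fin d))} {C : ℕ}
    (hC : ∀ b, C ≤ (applyWord τ [b]).length) (w : List (Fin d)) :
    C * w.length ≤ (applyWord τ w).length := by
  induction w with
  | nil => simp
  | cons b w ih =>
    rw [applyWord_cons, List.length_append, List.length_cons]
    have := hC b
    nlinarith

theorem exists_length_bound (τ : Monoid.End (FreeMonoid (Fin d))) :
    ∃ C, ∀ b, (applyWord τ [b]).length ≤ C :=
  ⟨∑ b, (applyWord τ [b]).length, fun b =>
    Finset.single_le_sum (f := fun b => (applyWord τ [b]).length) (fun _ _ => Nat.zero_le _)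
      (Finset.mem_univ b)⟩

theorem one_le_length_segProd {σ : ℤ → Monoid.End (FreeMonoid (Fin d))}
    (hσ : ∀ k, σ k ∈ unimodularSubstitutions d) (m n : ℤ) (b : Fin d) :
    1 ≤ (applyWord (segProd σ m n) [b]).length := by
  rw [segProd_eq]
  generalize List.range (n - m).toNat = l
  induction l with
  | nil => simp [applyWord_one]
  | cons k l ih =>
    rw [List.map_cons, List.prod_cons, applyWord_mul]
    have := le_length_applyWord (τ := σ (m + k)) (C := 1) (fun b => (hσ _).1 b)
      (applyWord ((l.map fun k : ℕ => σ (m + k)).prod) [b])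
    omega

theorem mem_applyWord_of_pos {τ : Monoid.End (FreeMonoid (Fin d))} {a b : Fin d}
    (h : 0 < realIncidence τ a b) : a ∈ applyWord τ [b] := by
  rw [realIncidence_apply, abelianization] at h
  exact List.count_pos_iff.1 (by exact_mod_cast h)

theorem exists_forall_mem_applyWord {σ : ℤ → Monoid.End (FreeMonoid (Fin d))}
    (hprim : IsPrimitiveSeq (incidenceSeq σ)) (m : ℤ) :
    ∃ n, m < n ∧ ∀ a b, a ∈ applyWord (segProd σ m n) [b] := by
  obtain ⟨n, hn, h⟩ := hprim m
  exact ⟨n, hn, fun a b => mem_applyWord_of_pos (by rw [← segProd_incidenceSeq]; exact h a b)⟩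

/-- The images of letters under `σ_{[n,m)}` become arbitrarily long: each positive block at
least doubles the lengths. -/
theorem exists_le_length_segProd (hd : 2 ≤ d) {σ : ℤ → Monoid.End (FreeMonoid (Fin d))}
    (hσ : ∀ k, σ k ∈ unimodularSubstitutions d) (hprim : IsPrimitiveSeq (incidenceSeq σ))
    (n : ℤ) (N : ℕ) :
    ∃ m, n < m ∧ ∀ m', m ≤ m' → ∀ b, N ≤ (applyWord (segProd σ n m') [b]).length := by
  induction N with
  | zero => exact ⟨n + 1, by omega, fun _ _ _ => Nat.zero_le _⟩
  | succ N ih =>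
    obtain ⟨m, hm, h⟩ := ih
    obtain ⟨l, hl, hpos⟩ := exists_forall_mem_applyWord hprim m
    refine ⟨l, by omega, fun m' hm' b => ?_⟩
    have h2 : ∀ b, 2 ≤ (applyWord (segProd σ m l) [b]).length := fun b => by
      rw [length_eq_sum_count]
      calc 2 ≤ d := hd
        _ = ∑ _a : Fin d, 1 := by simp
        _ ≤ _ := Finset.sum_le_sum fun a _ => List.count_pos_iff.2 (hpos a b)
    have h3 := le_length_applyWord h2 (applyWord (segProd σ l m') [b])
    rw [← applyWord_mul, segProd_mul σ hl.le hm'] at h3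
    have h4 := one_le_length_segProd hσ l m' b
    have h5 := le_length_applyWord (h m le_rfl) (applyWord (segProd σ m m') [b])
    rw [← applyWord_mul, segProd_mul σ hm.le (by omega)] at h5
    have h6 := le_length_applyWord (C := 1) (one_le_length_segProd hσ n m)
      (applyWord (segProd σ m m') [b])
    rw [← applyWord_mul, segProd_mul σ hm.le (by omega)] at h6
    rcases Nat.eq_zero_or_pos N with rfl | hN
    · omega
    · nlinarith

/-! ### Desubstitution of long words -/

theorem prefix_or_of_prefix_append {α : Type*} {x y z : List α} (h : y <+: x ++ z) :
    y <+: x ∨ ∃ t, y = x ++ t ∧ t <+: z := by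
  obtain ⟨r, hr⟩ := h
  rcases List.append_eq_append_iff.1 hr with ⟨t, h1, -⟩ | ⟨t, h1, h2⟩
  · exact Or.inl ⟨t, h1.symm⟩
  · exact Or.inr ⟨t, h1, r, h2.symm⟩

theorem prefix_applyWord {τ : Monoid.End (FreeMonoid (Fin d))} {C : ℕ}
    (hC : ∀ b, (applyWord τ [b]).length ≤ C) (z : List (Fin d)) :
    ∀ y, y <+: applyWord τ z → ∃ z' p, y = applyWord τ z' ++ p ∧ p.length ≤ C := by
  induction z with
  | nil =>
    intro y hy
    rw [applyWord_nil, List.prefix_nil] at hy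
    exact ⟨[], [], by simp [hy, applyWord_nil], by simp⟩
  | cons b z ih =>
    intro y hy
    rw [applyWord_cons] at hy
    rcases prefix_or_of_prefix_append hy with hy | ⟨t, rfl, ht⟩
    · exact ⟨[], y, by simp [applyWord_nil], hy.length_le.trans (hC b)⟩
    · obtain ⟨z', p, rfl, hp⟩ := ih t ht
      exact ⟨b :: z', p, by rw [applyWord_cons _ b z', List.append_assoc], hp⟩

theorem infix_applyWord {τ : Monoid.End (FreeMonoid (Fin d))} {C : ℕ}
    (hC : ∀ b, (applyWord τ [b]).length ≤ C) (z : List (Fin d)) :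
    ∀ y, y <:+: applyWord τ z →
      ∃ s z' p, y = s ++ applyWord τ z' ++ p ∧ s.length ≤ C ∧ p.length ≤ C := by
  induction z with
  | nil =>
    intro y hy
    rw [applyWord_nil, List.infix_nil] at hy
    exact ⟨[], [], [], by simp [hy, applyWord_nil], by simp, by simp⟩
  | cons b z ih =>
    intro y hy
    rw [applyWord_cons, List.infix_append_iff] at hy
    rcases hy with hy | hy | ⟨t, t', rfl, ht, ht'⟩
    · exact ⟨y, [], [], by simp [applyWord_nil], hy.length_le.trans (hC b), by simp⟩
    · exact ih y hy
    · obtain ⟨z', p, rfl, hp⟩ := prefix_applyWord hC z t' ht'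
      exact ⟨t, z', p, by simp, ht.length_le.trans (hC b), hp⟩

/-- A long word of the language of level `n` is, up to a short prefix and a short suffix,
an image under `σ_{[n,m)}`. -/
theorem exists_desubstitution {σ : ℤ → Monoid.End (FreeMonoid (Fin d))} {n m : ℤ} (hm : n ≤ m) :
    ∃ C : ℕ, ∀ y ∈ language σ n, C ≤ y.length →
      ∃ s z p, y = s ++ applyWord (segProd σ n m) z ++ p ∧ s.length ≤ C ∧ p.length ≤ C := by
  choose c hc using fun i : ℕ => exists_length_bound (segProd σ n (n + i))
  let D := ∑ i ∈ Finset.range ((m - n).toNat + 1), c i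
  have hD : ∀ m', n ≤ m' → m' ≤ m → ∀ b, (applyWord (segProd σ n m') [b]).length ≤ D := by
    intro m' h1 h2 b
    obtain ⟨i, rfl⟩ := Int.le.dest h1
    exact (hc i b).trans (Finset.single_le_sum (f := c) (fun _ _ => Nat.zero_le _)
      (Finset.mem_range.2 (by omega)))
  refine ⟨D + 1, fun y ⟨a, M, hM, hy⟩ hl => ?_⟩
  have hmM : m ≤ M := by
    by_contra hlt
    have := hD M hM.le (by omega) a
    have h2 := hy.length_le
    rw [applyWord_singleton] at this
    omega
  rw [← applyWord_singleton, ← segProd_mul σ hm hmM, applyWord_mul] at hy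
  obtain ⟨s, z, p, h1, h2, h3⟩ := infix_applyWord (hD m hm le_rfl) _ y hy
  exact ⟨s, z, p, h1, by omega, by omega⟩

/-- Primitivity implies that every word of the language occurs in every long enough word. -/
theorem exists_forall_infix {σ : ℤ → Monoid.End (FreeMonoid (Fin d))}
    (hprim : IsPrimitiveSeq (incidenceSeq σ)) {n : ℤ} {w : List (Fin d)} (hw : w ∈ language σ n) :
    ∃ N : ℕ, ∀ y ∈ language σ n, N ≤ y.length → w <:+: y := by
  obtain ⟨a, m, hm, hw⟩ := hw
  obtain ⟨l, hl, hpos⟩ := exists_forall_mem_applyWord hprim m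
  obtain ⟨C, hC⟩ := exists_desubstitution (σ := σ) (show n ≤ l by omega)
  -- a longer word contains the full image of some letter `b`, hence that of `a`, hence `w`
  refine ⟨2 * C + 1, fun y hy hyl => ?_⟩
  obtain ⟨s, z, p, rfl, hs, hp⟩ := hC y hy (by omega)
  cases z with
  | nil => simp [applyWord_nil] at hyl; omega
  | cons b z =>
    obtain ⟨x, x', hx⟩ := List.append_of_mem (hpos a b)
    have h1 : applyWord (segProd σ n m) [a] <:+: applyWord (segProd σ n l) [b] := by
      rw [← segProd_mul σ hm.le hl.le, applyWord_mul, hx, applyWord_append, applyWord_cons _ a x']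
      exact ⟨applyWord (segProd σ n m) x, applyWord (segProd σ n m) x', by simp [List.append_assoc]⟩
    have h2 : applyWord (segProd σ n l) [b] <:+: s ++ applyWord (segProd σ n l) (b :: z) ++ p := by
      rw [applyWord_cons _ b z]
      exact ⟨s, applyWord (segProd σ n l) z ++ p, by simp⟩
    exact hw.trans (h1.trans h2)

/-! ### Cones and uniform letter frequencies -/

theorem mulVec_nonneg_of_realIncidence (τ : Monoid.End (FreeMonoid (Fin d))) {x : Fin d → ℝ}
    (hx : ∀ i, 0 ≤ x i) (i : Fin d) : 0 ≤ (realIncidence τ).mulVec x i := by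
  rw [Matrix.mulVec, dotProduct]
  refine Finset.sum_nonneg fun j _ => mul_nonneg ?_ (hx j)
  rw [realIncidence_apply]
  exact abelianization_nonneg _ _

/-- The vector of level `n` spans the intersection of the cones `M_{[n,m)} ℝ_{≥0}^d`: the
property assumed at level `0` passes to every level because the matrices are invertible. -/
theorem levelVector_spans_cone {σ : ℤ → Monoid.End (FreeMonoid (Fin d))}
    (hσ : ∀ k, σ k ∈ unimodularSubstitutions d) {u : Fin d → ℝ}
    (hu : IsGeneralizedRightEigenvector (incidenceSeq σ) u) (n : ℤ) :
    (∀ i, 0 ≤ levelVector (incidenceSeq σ) u n i) ∧ levelVector (incidenceSeq σ) u n ≠ 0 ∧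
      ∀ x, (∀ m, n ≤ m → ∀ i, 0 ≤ ((segProd (incidenceSeq σ) n m)⁻¹.mulVec x) i) →
        x ∈ ray (levelVector (incidenceSeq σ) u n) := by
  obtain ⟨hu0, hune, hcone⟩ := hu
  set M := incidenceSeq σ with hM
  have hinv : ∀ a b, (segProd M a b)⁻¹ * segProd M a b = 1 := fun a b =>
    Matrix.nonsing_inv_mul _ (isUnit_det_segProd hσ a b)
  have hinv' : ∀ a b, segProd M a b * (segProd M a b)⁻¹ = 1 := fun a b =>
    Matrix.mul_nonsing_inv _ (isUnit_det_segProd hσ a b)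
  have hpos : ∀ a b x, (∀ i, 0 ≤ x i) → ∀ i, 0 ≤ (segProd M a b).mulVec x i := by
    intro a b x hx i
    rw [hM, segProd_incidenceSeq]
    exact mulVec_nonneg_of_realIncidence _ hx i
  have humem : u ∈ ray u := ⟨1, zero_le_one, (one_smul _ _).symm⟩
  rcases le_or_gt 0 n with hn | hn
  · have hv : levelVector M u n = (segProd M 0 n)⁻¹.mulVec u := by simp [levelVector, hn]
    have huv : (segProd M 0 n).mulVec (levelVector M u n) = u := by
      rw [hv, Matrix.mulVec_mulVec, hinv', Matrix.one_mulVec]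
    refine ⟨?_, ?_, ?_⟩
    · obtain ⟨k, rfl⟩ := Int.eq_ofNat_of_zero_le hn
      rw [← hcone, mem_iInter] at humem
      obtain ⟨x, hx, hxu⟩ := humem k
      have : levelVector M u k = x := by
        rw [hv, ← hxu, Matrix.mulVec_mulVec, hinv, Matrix.one_mulVec]
      rw [this]; exact hx
    · intro h0
      rw [h0, Matrix.mulVec_zero] at huv
      exact hune huv.symm
    · intro x hx
      have hy : (segProd M 0 n).mulVec x ∈ ray u := by
        rw [← hcone, mem_iInter]
        intro k
        rcases le_total n k with hk | hk
        · refine ⟨(segProd M n k)⁻¹.mulVec x, hx k hk, ?_⟩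
          simp only
          rw [← segProd_mul M hn hk, Matrix.mulVec_mulVec, mul_assoc, hinv', mul_one]
        · refine ⟨(segProd M k n).mulVec x, hpos _ _ _ ?_, ?_⟩
          · simpa [segProd_self] using hx n le_rfl
          · simp only
            rw [Matrix.mulVec_mulVec, segProd_mul M (by omega) hk]
      obtain ⟨c, hc, hcu⟩ := hy
      refine ⟨c, hc, ?_⟩
      rw [hv, ← Matrix.mulVec_smul, ← hcu, Matrix.mulVec_mulVec, hinv, Matrix.one_mulVec]
  · have hv : levelVector M u n = (segProd M n 0).mulVec u := by simp [levelVector, not_le.2 hn]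
    refine ⟨by rw [hv]; exact hpos _ _ _ hu0, ?_, ?_⟩
    · intro h0
      apply hune
      rw [hv] at h0
      rw [← Matrix.one_mulVec u, ← hinv n 0, ← Matrix.mulVec_mulVec, h0, Matrix.mulVec_zero]
    · intro x hx
      have hy : (segProd M n 0)⁻¹.mulVec x ∈ ray u := by
        rw [← hcone, mem_iInter]
        intro k
        refine ⟨(segProd M n k)⁻¹.mulVec x, hx k (by omega), ?_⟩
        simp only
        have h1 : segProd M 0 k = (segProd M n 0)⁻¹ * segProd M n k := by
          rw [← segProd_mul M hn.le (by omega : (0 : ℤ) ≤ k), ← mul_assoc, hinv, one_mul]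
        rw [h1, Matrix.mulVec_mulVec, mul_assoc, hinv', mul_one]
      obtain ⟨c, hc, hcu⟩ := hy
      refine ⟨c, hc, ?_⟩
      rw [hv, ← Matrix.mulVec_smul, ← hcu, Matrix.mulVec_mulVec, hinv', Matrix.one_mulVec]

/-- The multiple of `v` whose coordinates sum to `1`. -/
noncomputable def normalize (v : Fin d → ℝ) : Fin d → ℝ := (∑ i, v i)⁻¹ • v

theorem sum_pos_of_nonneg {v : Fin d → ℝ} (h0 : ∀ i, 0 ≤ v i) (hne : v ≠ 0) : 0 < ∑ i, v i := by
  refine lt_of_le_of_ne (Finset.sum_nonneg fun i _ => h0 i) fun h => hne ?_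
  ext i
  exact (Finset.sum_eq_zero_iff_of_nonneg fun i _ => h0 i).1 h.symm i (Finset.mem_univ i)

theorem sum_normalize {v : Fin d → ℝ} (h : ∑ i, v i ≠ 0) : ∑ i, normalize v i = 1 := by
  simp [normalize, ← Finset.mul_sum, h]

theorem abelianization_le_length (w : List (Fin d)) (i : Fin d) :
    abelianization w i ≤ w.length := by
  simpa [abelianization] using List.count_le_length

/-- Letter frequencies are uniform in the language of level `n`: a long word is essentially
the image under `σ_{[n,m)}` of some word, so that its abelianization lies close to the cone
`M_{[n,m)} ℝ_{≥0}^d`, and these cones shrink to a ray. -/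
theorem exists_letter_frequency_bound {σ : ℤ → Monoid.End (FreeMonoid (Fin d))}
    (hσ : ∀ k, σ k ∈ unimodularSubstitutions d) {n : ℤ} {v : Fin d → ℝ}
    (hcone : ∀ x, (∀ m, n ≤ m → ∀ i, 0 ≤ ((segProd (incidenceSeq σ) n m)⁻¹.mulVec x) i) →
        x ∈ ray v) {ε : ℝ} (hε : 0 < ε) :
    ∃ N : ℕ, ∀ y ∈ language σ n, N ≤ y.length →
      ‖(y.length : ℝ)⁻¹ • abelianization y - normalize v‖ ≤ ε := by
  set M := incidenceSeq σ with hM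
  -- the sections of the cones by the simplex, made nested by definition
  let K : ℕ → Set (Fin d → ℝ) := fun m =>
    {x | x ∈ stdSimplex ℝ (Fin d) ∧ ∀ j ≤ m, ∀ i, 0 ≤ ((segProd M n (n + j))⁻¹.mulVec x) i}
  have hKc : ∀ m, IsCompact (K m) := by
    intro m
    refine (isCompact_stdSimplex ℝ (Fin d)).inter_right (t := {x | ∀ j ≤ m, ∀ i, _}) ?_
    simp only [ofPred_forall]
    refine isClosed_iInter fun j => isClosed_iInter fun _ => isClosed_iInter fun i => ?_
    exact isClosed_le continuous_const
      ((continuous_apply i).comp (continuous_const.matrix_mulVec continuous_id))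
  have hKd : Directed (· ⊇ ·) K :=
    directed_of_isDirected_le fun a b hab x hx => ⟨hx.1, fun j hj => hx.2 j (hj.trans hab)⟩
  have hKi : ∀ x ∈ ⋂ m, K m, Metric.ball (normalize v) (ε / 2) ∈ nhds x := by
    intro x hx
    rw [mem_iInter] at hx
    have hxr : x ∈ ray v := by
      refine hcone x fun m hm => ?_
      obtain ⟨j, rfl⟩ := Int.le.dest hm
      exact (hx j).2 j le_rfl
    obtain ⟨c, -, rfl⟩ := hxr
    have h1 := (hx 0).1.2
    have hc : c = (∑ i, v i)⁻¹ := by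
      refine eq_inv_of_mul_eq_one_left ?_
      rw [← h1, Finset.mul_sum]
      rfl
    rw [hc]
    exact Metric.ball_mem_nhds _ (by positivity)
  obtain ⟨m, hm⟩ := exists_subset_nhds_of_isCompact hKd hKc hKi
  obtain ⟨C, hC⟩ := exists_desubstitution (σ := σ) (show n ≤ n + m by omega)
  -- replacing `y` by `σ_{[n,n+m)}(z)` changes the frequencies by at most `4 * C / y.length`
  obtain ⟨N, hN⟩ := exists_nat_gt (8 * C / ε)
  refine ⟨N + (2 * C + 1), fun y hy hyl => ?_⟩
  obtain ⟨s, z, p, hyeq, hs, hp⟩ := hC y hy (by omega)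
  set t := applyWord (segProd σ n (n + m)) z with ht
  have hlen : y.length = s.length + t.length + p.length := by rw [hyeq]; simp [add_assoc]
  have htpos : 0 < t.length := by omega
  have htposR : (0 : ℝ) < t.length := by exact_mod_cast htpos
  have hyposR : (0 : ℝ) < y.length := by exact_mod_cast (by omega : 0 < y.length)
  set x : Fin d → ℝ := (t.length : ℝ)⁻¹ • abelianization t with hx
  have hxK : x ∈ K m := by
    refine ⟨⟨fun i => ?_, ?_⟩, fun j hj i => ?_⟩
    · exact mul_nonneg (by positivity) (abelianization_nonneg _ _)
    · simp only [hx, Pi.smul_apply, smul_eq_mul, ← Finset.mul_sum, sum_abelianization]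
      exact inv_mul_cancel₀ htposR.ne'
    · have h1 : (segProd M n (n + j))⁻¹ * segProd M n (n + m) = segProd M (n + j) (n + m) := by
        rw [← segProd_mul M (show n ≤ n + j by omega) (show n + j ≤ n + (m : ℤ) by omega),
          ← mul_assoc, Matrix.nonsing_inv_mul _ (isUnit_det_segProd hσ _ _), one_mul]
      rw [hx, ht, abelianization_applyWord, ← segProd_incidenceSeq, Matrix.mulVec_smul,
        Matrix.mulVec_mulVec, h1, segProd_incidenceSeq]
      exact mul_nonneg (by positivity)
        (mulVec_nonneg_of_realIncidence _ (abelianization_nonneg _) i)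
  have hxv : ‖x - normalize v‖ < ε / 2 := by
    have := hm hxK
    rwa [mem_ball_iff_norm] at this
  have hyx : ‖(y.length : ℝ)⁻¹ • abelianization y - x‖ ≤ ε / 2 := by
    rw [pi_norm_le_iff_of_nonneg (by positivity)]
    intro i
    have hx0 : 0 ≤ x i := hxK.1.1 i
    have hx1 : x i ≤ 1 := (mem_Icc_of_mem_stdSimplex hxK.1 i).2
    have e1 : abelianization t i = t.length * x i := by
      simp only [hx, Pi.smul_apply, smul_eq_mul]
      field_simp
    have e2 : abelianization y i = abelianization s i + t.length * x i + abelianization p i := by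
      rw [hyeq, abelianization_append, abelianization_append, ← e1]; rfl
    have hlenR : (y.length : ℝ) = s.length + t.length + p.length := by exact_mod_cast hlen
    have hsR : (s.length : ℝ) ≤ C := by exact_mod_cast hs
    have hpR : (p.length : ℝ) ≤ C := by exact_mod_cast hp
    have h4 : 4 * (C : ℝ) ≤ ε / 2 * y.length := by
      have h5 : (N : ℝ) ≤ y.length := by exact_mod_cast (by omega : N ≤ y.length)
      have h6 : 8 * (C : ℝ) < y.length * ε := by
        rw [← div_lt_iff₀ hε]; linarith
      linarith
    have e3 : ((y.length : ℝ)⁻¹ • abelianization y - x) i =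
        (abelianization s i + abelianization p i - (s.length + p.length) * x i) / y.length := by
      simp only [Pi.sub_apply, Pi.smul_apply, smul_eq_mul, e2]
      field_simp
      rw [hlenR]; ring
    rw [e3, Real.norm_eq_abs, abs_div, abs_of_pos hyposR, div_le_iff₀ hyposR]
    refine le_trans ?_ h4
    have := abelianization_nonneg s i
    have := abelianization_nonneg p i
    have := abelianization_le_length s i
    have := abelianization_le_length p i
    have hsp : (0 : ℝ) ≤ s.length + p.length := by positivity
    rw [abs_le]
    constructor <;> nlinarith
  calc _ = ‖((y.length : ℝ)⁻¹ • abelianization y - x) + (x - normalize v)‖ := by congr 1; abel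
    _ ≤ _ := norm_add_le _ _
    _ ≤ ε := by linarith

/-! ### Uniform frequencies of words -/

/-- Splitting an image into the images of its letters costs at most `K` per letter. -/
theorem abs_quasiAdditive_applyWord_le {φ : List (Fin d) → ℝ} {K : ℝ} (hφ0 : φ [] = 0)
    (hφ : ∀ x y, |φ (x ++ y) - φ x - φ y| ≤ K) (τ : Monoid.End (FreeMonoid (Fin d)))
    (z : List (Fin d)) :
    |φ (applyWord τ z) - (fun b => φ (applyWord τ [b])) ⬝ᵥ abelianization z| ≤ K * z.length := by
  induction z with
  | nil => simp [applyWord_nil, hφ0, abelianization_nil]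
  | cons b z ih =>
    rw [applyWord_cons τ b z, abelianization_cons b z, dotProduct_add, abelianization_singleton,
      dotProduct_single_one, List.length_cons]
    have h := hφ (applyWord τ [b]) (applyWord τ z)
    push_cast
    rw [abs_le] at *
    constructor <;> linarith [h.1, h.2, ih.1, ih.2]

/-- A function on words that is additive up to a bounded error has a uniform mean on the
language of level `n`.  On the image `σ_{[n,m)}(z)` it is, up to an error that is small compared
to the length, a linear function of the abelianization of `z`, hence, as the incidence matrix is
invertible, of the abelianization of the word itself. -/
theorem exists_mean_of_quasiAdditive (hd : 2 ≤ d) {σ : ℤ → Monoid.End (FreeMonoid (Fin d))}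
    (hσ : ∀ k, σ k ∈ unimodularSubstitutions d) (hprim : IsPrimitiveSeq (incidenceSeq σ))
    {n : ℤ} {v : Fin d → ℝ}
    (hcone : ∀ x, (∀ m, n ≤ m → ∀ i, 0 ≤ ((segProd (incidenceSeq σ) n m)⁻¹.mulVec x) i) →
        x ∈ ray v)
    {φ : List (Fin d) → ℝ} {K : ℝ} (hφ0 : ∀ y, |φ y| ≤ y.length)
    (hφ : ∀ x y, |φ (x ++ y) - φ x - φ y| ≤ K) {ε : ℝ} (hε : 0 < ε) :
    ∃ (F : ℝ) (N : ℕ), ∀ y ∈ language σ n, N ≤ y.length → |φ y - F * y.length| ≤ ε * y.length := by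
  have hK : 0 ≤ K := (abs_nonneg _).trans (hφ [] [])
  obtain ⟨g, hg⟩ := exists_nat_gt (3 * K / ε)
  have hgpos : (0 : ℝ) < g := lt_of_le_of_lt (by positivity) hg
  obtain ⟨m, hnm, hm⟩ := exists_le_length_segProd hd hσ hprim n g
  set τ := segProd σ n m with hτ
  set B := segProd (incidenceSeq σ) n m with hB
  obtain ⟨C, hC⟩ := exists_desubstitution (σ := σ) hnm.le
  -- the mean as a linear function of the letter frequencies
  let Θ : (Fin d → ℝ) →L[ℝ] ℝ := LinearMap.toContinuousLinearMap
    { toFun := fun x => (fun b => φ (applyWord τ [b])) ⬝ᵥ (B⁻¹.mulVec x)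
      map_add' := fun x y => by rw [Matrix.mulVec_add, dotProduct_add]
      map_smul' := fun c x => by rw [Matrix.mulVec_smul, dotProduct_smul]; rfl }
  have hΘ : ∀ x, Θ x = (fun b => φ (applyWord τ [b])) ⬝ᵥ (B⁻¹.mulVec x) := fun _ => rfl
  obtain ⟨N₁, hN₁⟩ := exists_letter_frequency_bound hσ hcone
    (ε := ε / (3 * (‖Θ‖ + 1))) (by positivity)
  obtain ⟨N₂, hN₂⟩ := exists_nat_gt (3 * (2 * K + 2 * C + ‖Θ‖ * (2 * C)) / ε)
  refine ⟨Θ (normalize v), N₁ + N₂ + C + 1, fun y hy hyl => ?_⟩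
  obtain ⟨s, z, p, hyeq, hs, hp⟩ := hC y hy (by omega)
  have hypos : (0 : ℝ) < y.length := by exact_mod_cast (by omega : 0 < y.length)
  have hsR : (s.length : ℝ) ≤ C := by exact_mod_cast hs
  have hpR : (p.length : ℝ) ≤ C := by exact_mod_cast hp
  -- the blocks `σ_{[n,m)}(b)` are so long that their number is small compared to the length
  have h1 : |φ (applyWord τ z) - (fun b => φ (applyWord τ [b])) ⬝ᵥ abelianization z|
      ≤ ε / 3 * y.length := by
    refine (abs_quasiAdditive_applyWord_le (by simpa using hφ0 []) hφ τ z).trans ?_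
    have h2 := le_length_applyWord (hm m le_rfl) z
    have h3 : (g : ℝ) * z.length ≤ y.length := by
      have : g * z.length ≤ y.length := by
        rw [hyeq, List.length_append, List.length_append]
        omega
      exact_mod_cast this
    rw [div_lt_iff₀ hε] at hg
    have h4 : 3 * K * z.length ≤ g * ε * z.length := by gcongr
    nlinarith
  have h2 : |φ y - φ (applyWord τ z)| ≤ 2 * K + 2 * C := by
    have ha := hφ (s ++ applyWord τ z) p
    have hb := hφ s (applyWord τ z)
    have hc := hφ0 s
    have he := hφ0 p
    rw [← hyeq] at ha
    rw [abs_le] at *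
    constructor <;> linarith [ha.1, ha.2, hb.1, hb.2, hc.1, hc.2, he.1, he.2]
  have h3 : (fun b => φ (applyWord τ [b])) ⬝ᵥ abelianization z =
      Θ (abelianization y) - Θ (abelianization s + abelianization p) := by
    rw [← map_sub]
    have e : abelianization y - (abelianization s + abelianization p)
        = B.mulVec (abelianization z) := by
      rw [hB, segProd_incidenceSeq, ← abelianization_applyWord, hyeq, abelianization_append,
        abelianization_append]
      abel
    rw [e, hΘ, Matrix.mulVec_mulVec, hB, Matrix.nonsing_inv_mul _ (isUnit_det_segProd hσ _ _),
      Matrix.one_mulVec]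
  have h4 : |Θ (abelianization s + abelianization p)| ≤ ‖Θ‖ * (2 * C) := by
    refine (Θ.le_opNorm _).trans (mul_le_mul_of_nonneg_left ?_ (norm_nonneg _))
    rw [pi_norm_le_iff_of_nonneg (by positivity)]
    intro i
    have := abelianization_nonneg s i
    have := abelianization_nonneg p i
    have := abelianization_le_length s i
    have := abelianization_le_length p i
    rw [Pi.add_apply, Real.norm_eq_abs, abs_of_nonneg (by positivity)]
    linarith
  have h5 : |Θ (abelianization y) - Θ (normalize v) * y.length| ≤ ε / 3 * y.length := by
    have e : Θ (abelianization y) - Θ (normalize v) * y.length =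
        Θ ((y.length : ℝ)⁻¹ • abelianization y - normalize v) * y.length := by
      rw [map_sub, map_smul, smul_eq_mul]
      field_simp
    rw [e, abs_mul, abs_of_pos hypos]
    refine mul_le_mul_of_nonneg_right ?_ hypos.le
    refine (Θ.le_opNorm _).trans ?_
    have h6 := hN₁ y hy (by omega)
    calc ‖Θ‖ * _ ≤ (‖Θ‖ + 1) * (ε / (3 * (‖Θ‖ + 1))) := by
          gcongr; linarith
      _ = ε / 3 := by field_simp
  have h6 : 2 * K + 2 * C + ‖Θ‖ * (2 * C) ≤ ε / 3 * y.length := by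
    have h7 : (N₂ : ℝ) ≤ y.length := by exact_mod_cast (by omega : N₂ ≤ y.length)
    rw [div_lt_iff₀ hε] at hN₂
    have : (N₂ : ℝ) * ε ≤ y.length * ε := by gcongr
    linarith
  rw [h3] at h1
  rw [abs_le] at *
  constructor <;> linarith [h1.1, h1.2, h2.1, h2.2, h4.1, h4.2, h5.1, h5.2]

/-! ### Counting occurrences -/

theorem factor_succ (ω : ℤ → Fin d) (i : ℤ) (k : ℕ) :
    factor ω i (k + 1) = ω i :: factor ω (i + 1) k := by
  simp only [factor_eq, List.range_succ_eq_map, List.map_cons, List.map_map]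
  congr 1
  · simp
  · refine List.map_congr_left fun j _ => ?_
    simp only [Function.comp_apply]
    congr 1
    push_cast
    ring

theorem length_factor (ω : ℤ → Fin d) (i : ℤ) (k : ℕ) : (factor ω i k).length = k := by
  simp [factor_eq]

theorem factor_add (ω : ℤ → Fin d) (i : ℤ) (k l : ℕ) :
    factor ω i (k + l) = factor ω i k ++ factor ω (i + k) l := by
  induction k generalizing i with
  | zero => simp [factor_eq]
  | succ k ih =>
    rw [Nat.add_right_comm, factor_succ, factor_succ, ih, List.cons_append]
    congr 3
    push_cast
    ring

theorem take_factor (ω : ℤ → Fin d) (i : ℤ) {k l : ℕ} (h : k ≤ l) :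
    (factor ω i l).take k = factor ω i k := by
  obtain ⟨j, rfl⟩ := Nat.exists_eq_add_of_le h
  rw [factor_add, List.take_left' (length_factor _ _ _)]

theorem factor_eq_factor_iff {ω η : ℤ → Fin d} {i j : ℤ} {k : ℕ} :
    factor ω i k = factor η j k ↔ ∀ l : ℕ, l < k → ω (i + l) = η (j + l) := by
  simp [factor_eq]

open Classical in
/-- The number of positions of a word at which an element of `S`, a set of words of length `k`,
begins. -/
noncomputable def occurrences (S : Set (List (Fin d))) (k : ℕ) : List (Fin d) → ℕ
  | [] => 0
  | a :: y => (if (a :: y).take k ∈ S then 1 else 0) + occurrences S k y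

theorem occurrences_le_length (S : Set (List (Fin d))) (k : ℕ) (y : List (Fin d)) :
    occurrences S k y ≤ y.length := by
  induction y with
  | nil => simp [occurrences]
  | cons a y ih =>
    rw [occurrences, List.length_cons]
    split_ifs <;> omega

theorem occurrences_append {S : Set (List (Fin d))} {k : ℕ} (hS : ∀ w ∈ S, w.length = k)
    (x y : List (Fin d)) :
    occurrences S k x + occurrences S k y ≤ occurrences S k (x ++ y) ∧
      occurrences S k (x ++ y) ≤ occurrences S k x + occurrences S k y + min x.length k := by
  induction x with
  | nil => simp [occurrences]
  | cons a x ih =>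
    simp only [List.cons_append, occurrences]
    rcases le_or_gt k (x.length + 1) with h | h
    · have e : (a :: (x ++ y)).take k = (a :: x).take k := by
        rw [← List.cons_append, List.take_append_of_le_length (by simpa using h)]
      rw [e]
      simp only [List.length_cons]
      omega
    · have e : (a :: x).take k ∉ S := fun hmem => by
        have := hS _ hmem
        simp only [List.length_take, List.length_cons] at this
        omega
      rw [if_neg e]
      simp only [List.length_cons]
      split_ifs <;> omega

open Classical in
/-- The occurrences inside a factor miss only those windows of the bi-infinite word that stick out
of the factor at its right end. -/
theorem occurrences_factor {S : Set (List (Fin d))} {k : ℕ} (hS : ∀ w ∈ S, w.length = k)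
    (ω : ℤ → Fin d) (N : ℕ) (i : ℤ) :
    occurrences S k (factor ω i N) ≤
        ∑ j ∈ Finset.range N, (if factor ω (i + j) k ∈ S then 1 else 0) ∧
      ∑ j ∈ Finset.range N, (if factor ω (i + j) k ∈ S then 1 else 0) ≤
        occurrences S k (factor ω i N) + min N k := by
  induction N generalizing i with
  | zero => simp [factor_eq, occurrences]
  | succ N ih =>
    rw [Finset.sum_range_succ', factor_succ, occurrences, ← factor_succ]
    have ih' := ih (i + 1)
    have e : ∀ j : ℕ, i + ((j + 1 : ℕ) : ℤ) = i + 1 + j := fun j => by push_cast; ring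
    simp only [e, Nat.cast_zero, add_zero]
    rcases le_or_gt k (N + 1) with h | h
    · rw [take_factor _ _ h]
      omega
    · have e : (factor ω i (N + 1)).take k ∉ S := fun hmem => by
        have := hS _ hmem
        simp only [List.length_take, length_factor] at this
        omega
      rw [if_neg e]
      split_ifs <;> omega

/-! ### Unique ergodicity and minimality of the shift -/

/-- `A` depends only on the coordinates with index in `[-N, N)`. -/
def DependsOnWindow (N : ℕ) (A : Set (ℤ → Fin d)) : Prop :=
  ∀ ω η : ℤ → Fin d, (∀ i : ℤ, -N ≤ i → i < N → ω i = η i) → ω ∈ A → η ∈ A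

theorem DependsOnWindow.measurableSet {N : ℕ} {A : Set (ℤ → Fin d)} (h : DependsOnWindow N A) :
    MeasurableSet A := by
  let g : (ℤ → Fin d) → (Finset.Ico (-N : ℤ) N → Fin d) := fun ω i => ω i
  have hg : Measurable g := measurable_pi_lambda _ fun i => measurable_pi_apply _
  have e : A = g ⁻¹' (g '' A) := by
    refine (subset_preimage_image g A).antisymm fun η ⟨ω, hω, hg⟩ => h ω η (fun i h1 h2 => ?_) hω
    exact congrFun hg ⟨i, Finset.mem_Ico.2 ⟨h1, h2⟩⟩
  rw [e]
  exact hg (Set.toFinite _).measurableSet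

theorem shiftMap_iterate_apply {σ : ℤ → Monoid.End (FreeMonoid (Fin d))} {n : ℤ}
    (ω : shiftSpace σ n) (j : ℕ) (i : ℤ) : ((shiftMap σ n)^[j] ω).1 i = ω.1 (i + j) := by
  induction j generalizing i with
  | zero => simp
  | succ j ih =>
    rw [Function.iterate_succ_apply']
    change ((shiftMap σ n)^[j] ω).1 (i + 1) = _
    rw [ih]
    exact congrArg ω.1 (by push_cast; ring)

theorem factor_shiftMap_iterate {σ : ℤ → Monoid.End (FreeMonoid (Fin d))} {n : ℤ}
    (ω : shiftSpace σ n) (j : ℕ) (i : ℤ) (k : ℕ) :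
    factor ((shiftMap σ n)^[j] ω).1 i k = factor ω.1 (i + j) k := by
  rw [factor_eq_factor_iff]
  intro l _
  rw [shiftMap_iterate_apply]
  exact congrArg ω.1 (by ring)

theorem measurable_shiftMap (σ : ℤ → Monoid.End (FreeMonoid (Fin d))) (n : ℤ) :
    Measurable (shiftMap σ n) := by
  refine Measurable.subtype_mk (measurable_pi_lambda _ fun k => ?_)
  exact (measurable_pi_apply (k + 1)).comp measurable_subtype_coe

/-- An invariant probability measure gives every cylinder its uniform frequency. -/
theorem abs_measureReal_sub_mean_le {σ : ℤ → Monoid.End (FreeMonoid (Fin d))} {n : ℤ}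
    {S : Set (List (Fin d))} {k : ℕ} (hS : ∀ w ∈ S, w.length = k) {F ε : ℝ} {N : ℕ}
    (hF : ∀ y ∈ language σ n, N ≤ y.length →
      |(occurrences S k y : ℝ) - F * y.length| ≤ ε * y.length)
    {ν : Measure (shiftSpace σ n)} [IsProbabilityMeasure ν]
    (hν : MeasurePreserving (shiftMap σ n) ν ν)
    (hmeas : MeasurableSet {ω : shiftSpace σ n | factor ω.1 0 k ∈ S}) {N' : ℕ} (hN' : N ≤ N') :
    |ν.real {ω : shiftSpace σ n | factor ω.1 0 k ∈ S} * N' - F * N'| ≤ ε * N' + k := by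
  classical
  set A := {ω : shiftSpace σ n | factor ω.1 0 k ∈ S} with hA
  have hm : ∀ j : ℕ, MeasurableSet ((shiftMap σ n)^[j] ⁻¹' A) := fun j =>
    (hν.iterate j).measurable hmeas
  -- the number of visits to `A` up to time `N'`, whose mean is `N' * ν A` by invariance
  let f : shiftSpace σ n → ℝ := fun ω =>
    ∑ j ∈ Finset.range N', ((shiftMap σ n)^[j] ⁻¹' A).indicator (fun _ => (1 : ℝ)) ω
  have hint : ∀ j ∈ Finset.range N',
      Integrable (((shiftMap σ n)^[j] ⁻¹' A).indicator (fun _ => (1 : ℝ))) ν := fun j _ =>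
    (integrable_const 1).indicator (hm j)
  have hfint : Integrable f ν := integrable_finsetSum _ hint
  have h1 : ∫ ω, f ω ∂ν = ν.real A * N' := by
    rw [integral_finsetSum _ hint]
    have : ∀ j ∈ Finset.range N',
        ∫ ω, ((shiftMap σ n)^[j] ⁻¹' A).indicator (fun _ => (1 : ℝ)) ω ∂ν = ν.real A := by
      intro j _
      rw [integral_indicator_const _ (hm j), smul_eq_mul, mul_one,
        (hν.iterate j).measureReal_preimage hmeas.nullMeasurableSet]
    rw [Finset.sum_congr rfl this]
    simp [mul_comm]
  have h2 : ∀ ω, |f ω - F * N'| ≤ ε * N' + k := by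
    intro ω
    have e : f ω = ((∑ j ∈ Finset.range N',
        (if factor ω.1 (0 + j) k ∈ S then 1 else 0) : ℕ) : ℝ) := by
      push_cast
      refine Finset.sum_congr rfl fun j _ => ?_
      simp only [indicator_apply, mem_preimage, hA, mem_ofPred_eq, factor_shiftMap_iterate]
    obtain ⟨h3, h4⟩ := occurrences_factor hS ω.1 N' 0
    have h5 := hF (factor ω.1 0 N') (ω.2 0 N') (by rwa [length_factor])
    rw [length_factor] at h5
    rw [e]
    have h3' := (Nat.cast_le (α := ℝ)).2 h3
    have h4' := (Nat.cast_le (α := ℝ)).2 (h4.trans (Nat.add_le_add_left (min_le_right _ _) _))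
    rw [Nat.cast_add] at h4'
    rw [abs_le] at *
    constructor <;> linarith [h5.1, h5.2]
  have h3 : ν.real A * N' - F * N' = ∫ ω, (f ω - F * N') ∂ν := by
    rw [integral_sub hfint (integrable_const _), h1]
    simp
  rw [h3]
  have := norm_integral_le_of_norm_le_const (μ := ν) (f := fun ω => f ω - F * N')
    (Filter.Eventually.of_forall h2)
  simpa using this

/-- Two invariant probability measures agree on sets that depend on finitely many coordinates,
by the uniformity of frequencies. -/
theorem measure_eq_of_invariant (hd : 2 ≤ d) {σ : ℤ → Monoid.End (FreeMonoid (Fin d))}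
    (hσ : ∀ k, σ k ∈ unimodularSubstitutions d) (hprim : IsPrimitiveSeq (incidenceSeq σ))
    {n : ℤ} {v : Fin d → ℝ}
    (hcone : ∀ x, (∀ m, n ≤ m → ∀ i, 0 ≤ ((segProd (incidenceSeq σ) n m)⁻¹.mulVec x) i) →
        x ∈ ray v)
    {ν₁ ν₂ : Measure (shiftSpace σ n)} [IsProbabilityMeasure ν₁] [IsProbabilityMeasure ν₂]
    (hν₁ : MeasurePreserving (shiftMap σ n) ν₁ ν₁) (hν₂ : MeasurePreserving (shiftMap σ n) ν₂ ν₂) :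
    ν₁ = ν₂ := by
  let 𝒞 : Set (Set (shiftSpace σ n)) :=
    {A | ∃ (N : ℕ) (A' : Set (ℤ → Fin d)), DependsOnWindow N A' ∧ A = Subtype.val ⁻¹' A'}
  have hgen : (inferInstance : MeasurableSpace (shiftSpace σ n)) =
      MeasurableSpace.generateFrom 𝒞 := by
    refine le_antisymm ?_ (MeasurableSpace.generateFrom_le ?_)
    · change MeasurableSpace.comap _ MeasurableSpace.pi ≤ _
      rw [MeasurableSpace.comap_le_iff_le_map, MeasurableSpace.pi, iSup_le_iff]
      intro i
      rw [MeasurableSpace.comap_le_iff_le_map]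
      intro s _
      refine MeasurableSpace.measurableSet_generateFrom
        ⟨i.natAbs + 1, {ω | ω i ∈ s}, fun ω η h hω => ?_, rfl⟩
      have := h i (by omega) (by omega)
      rwa [mem_ofPred_eq, ← this]
    · rintro _ ⟨N, A', hA', rfl⟩
      exact measurable_subtype_coe hA'.measurableSet
  have hpi : IsPiSystem 𝒞 := by
    rintro _ ⟨N, A, hA, rfl⟩ _ ⟨N', A', hA', rfl⟩ -
    refine ⟨max N N', A ∩ A', fun ω η h hω => ⟨hA ω η (fun i h1 h2 => h i ?_ ?_) hω.1,
      hA' ω η (fun i h1 h2 => h i ?_ ?_) hω.2⟩, rfl⟩ <;> omega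
  refine ext_of_generate_finite 𝒞 hgen hpi ?_ (by simp)
  rintro _ ⟨M, A, hA, rfl⟩
  -- after `M` shifts, membership in `A` is read off from the first `2 * M` letters
  let S : Set (List (Fin d)) := (fun ω => factor ω (-M) (2 * M)) '' A
  have hS : ∀ w ∈ S, w.length = 2 * M := by
    rintro _ ⟨ω, -, rfl⟩
    exact length_factor _ _ _
  have hAS : (shiftMap σ n)^[M] ⁻¹' (Subtype.val ⁻¹' A) =
      {ω : shiftSpace σ n | factor ω.1 0 (2 * M) ∈ S} := by
    ext ω
    have e : factor ((shiftMap σ n)^[M] ω).1 (-M) (2 * M) = factor ω.1 0 (2 * M) := by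
      rw [factor_shiftMap_iterate]; congr 1; ring
    simp only [mem_preimage, mem_ofPred_eq, ← e]
    refine ⟨fun h => ⟨_, h, rfl⟩, fun ⟨η, hη, h⟩ => hA _ _ (fun i h1 h2 => ?_) hη⟩
    have := factor_eq_factor_iff.1 h (i + M).toNat (by omega)
    rwa [Int.toNat_of_nonneg (by omega), neg_add_cancel_comm_assoc] at this
  have hmA : MeasurableSet (Subtype.val ⁻¹' A : Set (shiftSpace σ n)) :=
    measurable_subtype_coe hA.measurableSet
  have hm := (hν₁.iterate M).measurable hmA
  rw [← (hν₁.iterate M).measure_preimage hmA.nullMeasurableSet,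
    ← (hν₂.iterate M).measure_preimage hmA.nullMeasurableSet]
  rw [hAS] at hm ⊢
  rw [← measureReal_eq_measureReal_iff]
  set a₁ := ν₁.real {ω : shiftSpace σ n | factor ω.1 0 (2 * M) ∈ S}
  set a₂ := ν₂.real {ω : shiftSpace σ n | factor ω.1 0 (2 * M) ∈ S}
  have hφ : ∀ x y : List (Fin d), |(occurrences S (2 * M) (x ++ y) : ℝ) -
      occurrences S (2 * M) x - occurrences S (2 * M) y| ≤ (2 * M : ℕ) := by
    intro x y
    obtain ⟨h1, h2⟩ := occurrences_append hS x y
    have h1' := (Nat.cast_le (α := ℝ)).2 h1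
    have h2' := (Nat.cast_le (α := ℝ)).2 (h2.trans (Nat.add_le_add_left (min_le_right _ _) _))
    rw [Nat.cast_add] at h1' h2'
    rw [Nat.cast_add] at h2'
    rw [abs_le]
    constructor <;> linarith
  have hφ0 : ∀ y : List (Fin d), |(occurrences S (2 * M) y : ℝ)| ≤ y.length := fun y => by
    rw [abs_of_nonneg (Nat.cast_nonneg _)]
    exact_mod_cast occurrences_le_length S _ y
  have key : ∀ ε > 0, |a₁ - a₂| ≤ ε := by
    intro ε hε
    obtain ⟨F, N, hF⟩ := exists_mean_of_quasiAdditive hd hσ hprim hcone hφ0 hφ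
      (ε := ε / 4) (by positivity)
    obtain ⟨N₁, hN₁⟩ := exists_nat_gt (4 * (2 * M : ℕ) / ε)
    have hb₁ := abs_measureReal_sub_mean_le hS hF hν₁ hm (le_max_left N (N₁ + 1))
    have hb₂ := abs_measureReal_sub_mean_le hS hF hν₂ hm (le_max_left N (N₁ + 1))
    change |a₁ * _ - _| ≤ _ at hb₁
    change |a₂ * _ - _| ≤ _ at hb₂
    set L : ℝ := ((max N (N₁ + 1) : ℕ) : ℝ) with hL
    have hL1 : (N₁ : ℝ) + 1 ≤ L := by
      rw [hL]; exact_mod_cast le_max_right _ _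
    have hLpos : 0 < L := by positivity
    rw [div_lt_iff₀ hε] at hN₁
    have h3 : ((2 * M : ℕ) : ℝ) ≤ ε / 4 * L := by nlinarith
    have h4 : |a₁ - a₂| * L ≤ ε * L := by
      rw [← abs_of_pos hLpos, ← abs_mul, abs_of_pos hLpos]
      rw [abs_le] at *
      constructor <;> linarith [hb₁.1, hb₁.2, hb₂.1, hb₂.2]
    exact le_of_mul_le_mul_right h4 hLpos
  have := le_of_forall_pos_le_add (a := |a₁ - a₂|) (b := 0) fun ε hε => by simpa using key ε hε
  exact sub_eq_zero.1 (abs_nonpos_iff.1 this)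

/-- The shift is minimal, because every word of the language recurs with bounded gaps. -/
theorem isMinimalMap_shiftMap {σ : ℤ → Monoid.End (FreeMonoid (Fin d))}
    (hprim : IsPrimitiveSeq (incidenceSeq σ)) (n : ℤ) : IsMinimalMap (shiftMap σ n) := by
  intro S hS hmaps
  refine S.eq_empty_or_nonempty.imp_right fun ⟨ω, hω⟩ => eq_univ_of_forall fun η => ?_
  have hiter : ∀ j : ℕ, (shiftMap σ n)^[j] ω ∈ S := fun j => hmaps.iterate j hω
  rw [← hS.closure_eq, closure_subtype, mem_closure_iff_nhds]
  intro t ht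
  rw [nhds_pi, Filter.mem_pi] at ht
  obtain ⟨I, hI, U, hU, hUt⟩ := ht
  obtain ⟨N, hN⟩ : ∃ N : ℕ, ∀ i ∈ I, i.natAbs < N := by
    obtain ⟨N, hN⟩ := (hI.image Int.natAbs).bddAbove
    exact ⟨N + 1, fun i hi => Nat.lt_succ_of_le (hN ⟨i, hi, rfl⟩)⟩
  obtain ⟨N', hN'⟩ := exists_forall_infix hprim (η.2 (-N) (2 * N))
  obtain ⟨x, y, hxy⟩ := hN' (factor ω.1 N N') (ω.2 _ _) (length_factor _ _ _).ge
  refine ⟨((shiftMap σ n)^[x.length + 2 * N] ω).1, hUt fun i hi => ?_, _, hiter _, rfl⟩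
  have hlen : x.length + 2 * N + y.length = N' := by
    have := congrArg List.length hxy
    simpa [length_factor, add_assoc] using this
  have e : factor η.1 (-N) (2 * N) = factor ω.1 (N + x.length) (2 * N) := by
    rw [← hlen, factor_add, factor_add] at hxy
    have h1 := List.append_inj_left' hxy (by simp [length_factor])
    exact List.append_inj_right h1 (by simp [length_factor])
  have hiN := hN i hi
  have h2 := factor_eq_factor_iff.1 e (i + N).toNat (by omega)
  rw [Int.toNat_of_nonneg (by omega), neg_add_cancel_comm_assoc] at h2
  rw [shiftMap_iterate_apply]
  have e2 : i + ((x.length + 2 * N : ℕ) : ℤ) = N + x.length + (i + N) := by push_cast; ring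
  rw [e2, ← h2]
  exact mem_of_mem_nhds (hU i)

variable {k : ℕ}

/-! ### The torus as a quotient of Euclidean space -/

/-- The covering map `ℝ^k → (ℝ/ℤ)^k`. -/
def toTorus (k : ℕ) : (Fin k → ℝ) →+ (Fin k → UnitAddCircle) where
  toFun x i := (x i : UnitAddCircle)
  map_zero' := rfl
  map_add' _ _ := rfl

theorem continuous_toTorus : Continuous (toTorus k) :=
  continuous_pi fun i => (AddCircle.continuous_mk' 1).comp (continuous_apply i)

theorem isOpenQuotientMap_toTorus : IsOpenQuotientMap (toTorus k) :=
  IsOpenQuotientMap.piMap fun _ => QuotientAddGroup.isOpenQuotientMap_mk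

theorem toTorus_eq_zero_iff {x : Fin k → ℝ} :
    toTorus k x = 0 ↔ ∃ z : Fin k → ℤ, x = fun i => (z i : ℝ) := by
  constructor
  · intro h
    have : ∀ i, ∃ z : ℤ, (z : ℝ) = x i := fun i => by
      obtain ⟨z, hz⟩ := (AddCircle.coe_eq_zero_iff (1 : ℝ)).1 (congrFun h i)
      exact ⟨z, by simpa using hz⟩
    choose z hz using this
    exact ⟨z, funext fun i => (hz i).symm⟩
  · rintro ⟨z, rfl⟩
    ext i
    exact (AddCircle.coe_eq_zero_iff (1 : ℝ)).2 ⟨z i, by simp⟩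

theorem toTorus_intCast (z : Fin k → ℤ) : toTorus k (fun i => (z i : ℝ)) = 0 :=
  toTorus_eq_zero_iff.2 ⟨z, rfl⟩

theorem toTorus_eq_iff {x y : Fin k → ℝ} :
    toTorus k x = toTorus k y ↔ ∃ z : Fin k → ℤ, x = y + fun i => (z i : ℝ) := by
  rw [← sub_eq_zero, ← map_sub, toTorus_eq_zero_iff]
  simp only [sub_eq_iff_eq_add']

theorem measurableSet_toTorus_image {C : Set (Fin k → ℝ)} (hC : IsClosed C) :
    MeasurableSet (toTorus k '' C) := by
  have h : IsSigmaCompact (toTorus k '' C) :=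
    (isSigmaCompact_univ.of_isClosed_subset hC (subset_univ _)).image continuous_toTorus
  obtain ⟨K, hK, hKC⟩ := h
  rw [← hKC]
  exact MeasurableSet.iUnion fun n => (hK n).measurableSet

theorem measurePreserving_toTorus : MeasurePreserving (toTorus k)
    (Measure.pi fun _ : Fin k => (volume : Measure ℝ).restrict (Ioc 0 (0 + 1))) volume :=
  measurePreserving_pi _ (fun _ => (volume : Measure UnitAddCircle)) fun _ => AddCircle.measurePreserving_mk 1 0

theorem volume_toTorus_image_eq_zero {C : Set (Fin k → ℝ)} (hC : IsClosed C)
    (h0 : volume C = 0) : volume (toTorus k '' C) = 0 := by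
  rw [← measurePreserving_toTorus.measure_preimage
    (measurableSet_toTorus_image hC).nullMeasurableSet, ← Measure.restrict_pi_pi]
  refine Measure.absolutelyContinuous_of_le Measure.restrict_le_self ?_
  have : toTorus k ⁻¹' (toTorus k '' C) ⊆
      ⋃ z : Fin k → ℤ, (fun x => (fun i => (z i : ℝ)) + x) ⁻¹' C := by
    rintro x ⟨y, hy, hxy⟩
    obtain ⟨z, rfl⟩ := toTorus_eq_iff.1 hxy
    exact mem_iUnion.2 ⟨z, by rwa [mem_preimage, add_comm]⟩
  refine measure_mono_null this (measure_iUnion_null fun z => ?_)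
  change volume _ = 0
  rw [measure_preimage_add, h0]

/-! ### Codings of torus rotations by periodic tilings -/

/-- Closed sets `R a ⊆ ℝ^k` whose translates by `ℤ^k` cover `ℝ^k` with overlaps of measure zero,
together with displacements `δ a`, all congruent to `α` modulo `ℤ^k`, such that each point of
`R a` admits, for each length, a word in `𝓛` beginning with `a` along which the successive
translations by the displacements stay in the sets prescribed by the letters. -/
structure IsExchangeTiling (R : Fin d → Set (Fin k → ℝ)) (δ : Fin d → Fin k → ℝ)
    (α : Fin k → UnitAddCircle) (𝓛 : Set (List (Fin d))) : Prop where
  isClosed : ∀ a, IsClosed (R a)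
  covers : ∀ t, ∃ q : (Fin k → ℝ) × Fin d, toTorus k q.1 = t ∧ q.1 ∈ R q.2
  null : ∀ (a a' : Fin d) (z : Fin k → ℤ), (z, a') ≠ (0, a) →
    volume (R a ∩ {x | (x + fun i => (z i : ℝ)) ∈ R a'}) = 0
  toTorus_displacement : ∀ a, toTorus k (δ a) = α
  exists_word : ∀ a, ∀ x ∈ R a, ∀ N : ℕ, ∃ w : ℕ → Fin d, w 0 = a ∧
    (∀ j ≤ N, x + ∑ i ∈ Finset.range j, δ (w i) ∈ R (w j)) ∧ (List.range N).map w ∈ 𝓛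
  dense : ∀ t, t ∈ closure (range fun j : ℕ => j • α)

/-- The points of the torus that have exactly one lift in exactly one of the sets `R a`. -/
def regularPoints (R : Fin d → Set (Fin k → ℝ)) : Set (Fin k → UnitAddCircle) :=
  {t | ∃! q : (Fin k → ℝ) × Fin d, toTorus k q.1 = t ∧ q.1 ∈ R q.2}

/-- The points of the torus whose orbit under the rotation by `α` is regular. -/
def regularOrbits (R : Fin d → Set (Fin k → ℝ)) (α : Fin k → UnitAddCircle) :
    Set (Fin k → UnitAddCircle) :=
  {t | ∀ j : ℤ, t + j • α ∈ regularPoints R}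

namespace IsExchangeTiling

variable {R : Fin d → Set (Fin k → ℝ)} {δ : Fin d → Fin k → ℝ} {α : Fin k → UnitAddCircle}
  {𝓛 : Set (List (Fin d))}

/-- A lift of a point of the torus to a point of one of the sets `R a`, with its letter `a`. -/
noncomputable def lift (h : IsExchangeTiling R δ α 𝓛) (t : Fin k → UnitAddCircle) :
    (Fin k → ℝ) × Fin d :=
  (h.covers t).choose

theorem toTorus_lift (h : IsExchangeTiling R δ α 𝓛) (t : Fin k → UnitAddCircle) :
    toTorus k (h.lift t).1 = t := (h.covers t).choose_spec.1

theorem lift_mem (h : IsExchangeTiling R δ α 𝓛) (t : Fin k → UnitAddCircle) :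
    (h.lift t).1 ∈ R (h.lift t).2 := (h.covers t).choose_spec.2

theorem lift_eq (h : IsExchangeTiling R δ α 𝓛) {t : Fin k → UnitAddCircle}
    (ht : t ∈ regularPoints R) {x : Fin k → ℝ} {a : Fin d} (hx : toTorus k x = t) (ha : x ∈ R a) :
    h.lift t = (x, a) :=
  ht.unique (h.covers t).choose_spec ⟨hx, ha⟩

theorem isClosed_overlap (h : IsExchangeTiling R δ α 𝓛) (a a' : Fin d) (z : Fin k → ℤ) :
    IsClosed (R a ∩ {x | (x + fun i => (z i : ℝ)) ∈ R a'}) :=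
  (h.isClosed a).inter ((h.isClosed a').preimage (continuous_id.add continuous_const))

/-- A point of the torus is irregular when it is the image of a point in an overlap of tiles. -/
theorem compl_regularPoints (h : IsExchangeTiling R δ α 𝓛) :
    (regularPoints R)ᶜ = ⋃ (a : Fin d) (a' : Fin d) (z : Fin k → ℤ) (_ : (z, a') ≠ (0, a)),
      toTorus k '' (R a ∩ {x | (x + fun i => (z i : ℝ)) ∈ R a'}) := by
  ext t
  simp only [mem_compl_iff, mem_iUnion]
  constructor
  · intro ht
    by_contra hne
    refine ht ⟨h.lift t, ⟨h.toTorus_lift t, h.lift_mem t⟩, fun q hq => ?_⟩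
    obtain ⟨z, hz⟩ := toTorus_eq_iff.1 (hq.1.trans (h.toTorus_lift t).symm)
    by_contra hqne
    refine hne ⟨(h.lift t).2, q.2, z, fun e => hqne ?_, (h.lift t).1,
      ⟨h.lift_mem t, by rw [mem_ofPred_eq, ← hz]; exact hq.2⟩, h.toTorus_lift t⟩
    obtain ⟨rfl, e2⟩ := Prod.mk.inj e
    refine Prod.ext ?_ e2
    rw [hz]
    ext i
    simp
  · rintro ⟨a, a', z, hne, x, ⟨hx, hx'⟩, rfl⟩ hreg
    have e := hreg.unique (y₁ := (x, a)) (y₂ := (x + fun i => (z i : ℝ), a')) ⟨rfl, hx⟩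
      ⟨by simp only [map_add, toTorus_intCast, add_zero], hx'⟩
    obtain ⟨e1, e2⟩ := Prod.mk.inj e
    refine hne (Prod.ext ?_ e2.symm)
    ext i
    have := congrFun e1 i
    simpa using this

theorem measurableSet_regularPoints (h : IsExchangeTiling R δ α 𝓛) :
    MeasurableSet (regularPoints R) := by
  refine MeasurableSet.of_compl ?_
  rw [h.compl_regularPoints]
  exact MeasurableSet.iUnion fun a => MeasurableSet.iUnion fun a' => MeasurableSet.iUnion fun z =>
    MeasurableSet.iUnion fun _ => measurableSet_toTorus_image (h.isClosed_overlap a a' z)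

theorem volume_compl_regularPoints (h : IsExchangeTiling R δ α 𝓛) :
    volume (regularPoints R)ᶜ = 0 := by
  rw [h.compl_regularPoints]
  exact measure_iUnion_null fun a => measure_iUnion_null fun a' => measure_iUnion_null fun z =>
    measure_iUnion_null fun hne =>
      volume_toTorus_image_eq_zero (h.isClosed_overlap a a' z) (h.null a a' z hne)

theorem regularOrbits_eq : regularOrbits R α = ⋂ j : ℤ, (· + j • α) ⁻¹' regularPoints R := by
  ext t; simp [regularOrbits]

theorem measurableSet_regularOrbits (h : IsExchangeTiling R δ α 𝓛) :
    MeasurableSet (regularOrbits R α) := by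
  rw [regularOrbits_eq]
  exact MeasurableSet.iInter fun j => (measurable_add_const _) h.measurableSet_regularPoints

theorem volume_compl_regularOrbits (h : IsExchangeTiling R δ α 𝓛) :
    volume (regularOrbits R α)ᶜ = 0 := by
  rw [regularOrbits_eq, compl_iInter]
  refine measure_iUnion_null fun j => ?_
  rw [← preimage_compl, (measurePreserving_add_right volume (j • α)).measure_preimage
    h.measurableSet_regularPoints.compl.nullMeasurableSet]
  exact h.volume_compl_regularPoints

theorem add_mem_regularOrbits {t : Fin k → UnitAddCircle} (ht : t ∈ regularOrbits R α) (j : ℤ) :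
    t + j • α ∈ regularOrbits R α := fun i => by
  rw [add_assoc, ← add_smul]
  exact ht _

/-- The coding of the orbit of a point of the torus with respect to the sets `R a`. -/
noncomputable def code (h : IsExchangeTiling R δ α 𝓛) (t : Fin k → UnitAddCircle) : ℤ → Fin d :=
  fun j => (h.lift (t + j • α)).2

theorem code_add (h : IsExchangeTiling R δ α 𝓛) (t : Fin k → UnitAddCircle) (i j : ℤ) :
    h.code (t + i • α) j = h.code t (i + j) := by
  simp only [code, add_assoc, ← add_smul]

theorem measurable_code (h : IsExchangeTiling R δ α 𝓛) :
    Measurable fun t : regularOrbits R α => h.code t := by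
  refine measurable_pi_lambda _ fun j => measurable_to_countable' fun a => ?_
  have e : (fun t : regularOrbits R α => h.code t j) ⁻¹' {a} =
      Subtype.val ⁻¹' ((· + j • α) ⁻¹' (toTorus k '' R a)) := by
    ext t
    simp only [mem_preimage, mem_singleton_iff, code]
    constructor
    · rintro rfl
      exact ⟨_, h.lift_mem _, h.toTorus_lift _⟩
    · rintro ⟨x, hx, hxt⟩
      rw [h.lift_eq (t.2 j) hxt hx]
  rw [e]
  exact measurable_subtype_coe
    ((measurable_add_const _) (measurableSet_toTorus_image (h.isClosed a)))

/-- Along a regular orbit the words provided by the tiling are the coding, and the lifts move by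
the displacements of the letters. -/
theorem code_spec (h : IsExchangeTiling R δ α 𝓛) {t : Fin k → UnitAddCircle}
    (ht : t ∈ regularOrbits R α) (N : ℕ) :
    (List.range N).map (fun j : ℕ => h.code t j) ∈ 𝓛 ∧
      (h.lift (t + N • α)).1 = (h.lift t).1 + ∑ j ∈ Finset.range N, δ (h.code t j) := by
  obtain ⟨w, -, hw, hwL⟩ := h.exists_word _ _ (h.lift_mem t) N
  have key : ∀ j ≤ N, h.lift (t + j • α) =
      ((h.lift t).1 + ∑ i ∈ Finset.range j, δ (w i), w j) := by
    intro j hj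
    have hreg := ht j
    rw [natCast_zsmul] at hreg
    refine h.lift_eq hreg ?_ (hw j hj)
    simp [map_add, map_sum, h.toTorus_displacement, h.toTorus_lift]
  have hcode : ∀ j ≤ N, h.code t j = w j := fun j hj => by
    rw [code, natCast_zsmul, key j hj]
  refine ⟨?_, ?_⟩
  · rw [List.map_congr_left fun j hj => hcode j (List.mem_range.1 hj).le]
    exact hwL
  · rw [key N le_rfl]
    simp only
    exact congrArg _ (Finset.sum_congr rfl fun j hj => by
      rw [hcode j (Finset.mem_range.1 hj).le])

theorem factor_code_mem (h : IsExchangeTiling R δ α 𝓛) {t : Fin k → UnitAddCircle}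
    (ht : t ∈ regularOrbits R α) (i : ℤ) (N : ℕ) : factor (h.code t) i N ∈ 𝓛 := by
  have := (h.code_spec (add_mem_regularOrbits ht i) N).1
  simpa only [code_add, ← factor_eq] using this

/-! ### Injectivity of the coding -/

/-- Forward orbits of the rotation visit every open set. -/
theorem exists_add_mem_toTorus_image (h : IsExchangeTiling R δ α 𝓛)
    (t : Fin k → UnitAddCircle) {W : Set (Fin k → ℝ)} (hW : IsOpen W) (hne : W.Nonempty) :
    ∃ j : ℕ, ∃ y ∈ W, toTorus k y = t + j • α := by
  have ho : IsOpen ((t + ·) ⁻¹' (toTorus k '' W)) :=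
    (isOpenQuotientMap_toTorus.isOpenMap W hW).preimage (continuous_const.add continuous_id)
  obtain ⟨y, hy⟩ := hne
  obtain ⟨_, ⟨z, hz, hzt⟩, j, rfl⟩ := mem_closure_iff.1 (h.dense (toTorus k y - t)) _ ho
    ⟨y, hy, (add_sub_cancel _ _).symm⟩
  exact ⟨j, z, hz, hzt⟩

theorem isClosed_iUnion (h : IsExchangeTiling R δ α 𝓛) : IsClosed (⋃ a, R a) :=
  isClosed_iUnion_of_finite h.isClosed

/-- The covering map is injective on the interior of the union of the sets `R a`: otherwise an
open set of points would have two lifts, and regular orbits visit every open set. -/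
theorem injOn_toTorus_interior (h : IsExchangeTiling R δ α 𝓛) {t : Fin k → UnitAddCircle}
    (ht : t ∈ regularOrbits R α) : InjOn (toTorus k) (interior (⋃ a, R a)) := by
  intro y hy y' hy' hyy
  set U := interior (⋃ a, R a) with hU
  by_contra hne
  have hW : IsOpen (U ∩ (fun x => x + (y' - y)) ⁻¹' U) :=
    isOpen_interior.inter (isOpen_interior.preimage (continuous_id.add continuous_const))
  obtain ⟨j, x, ⟨hx, hx'⟩, hxt⟩ := h.exists_add_mem_toTorus_image t hW
    ⟨y, hy, by rw [mem_preimage, add_sub_cancel]; exact hy'⟩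
  obtain ⟨a, ha⟩ := mem_iUnion.1 (interior_subset hx)
  obtain ⟨a', ha'⟩ := mem_iUnion.1 (interior_subset hx')
  have hreg := ht j
  rw [natCast_zsmul, ← hxt] at hreg
  have e := hreg.unique (y₁ := (x, a)) (y₂ := (x + (y' - y), a')) ⟨rfl, ha⟩
    ⟨by simp only [map_add, map_sub, hyy, sub_self, add_zero], ha'⟩
  have e1 := (Prod.mk.inj e).1
  rw [left_eq_add, sub_eq_zero] at e1
  exact hne e1.symm

/-- Countably many translates of the closed union cover, so the Baire category theorem applies. -/
theorem nonempty_interior (h : IsExchangeTiling R δ α 𝓛) : (interior (⋃ a, R a)).Nonempty := by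
  obtain ⟨z, hz⟩ := nonempty_interior_of_iUnion_of_closed
    (f := fun z : Fin k → ℤ => (fun x => x + fun i => (z i : ℝ)) ⁻¹' ⋃ a, R a)
    (fun z => h.isClosed_iUnion.preimage (continuous_id.add continuous_const))
    (eq_univ_of_forall fun x => by
      obtain ⟨q, hq, hqR⟩ := h.covers (toTorus k x)
      obtain ⟨z, hz⟩ := toTorus_eq_iff.1 hq
      exact mem_iUnion.2 ⟨z, by rw [mem_preimage, ← hz]; exact mem_iUnion.2 ⟨_, hqR⟩⟩)
  obtain ⟨x, hx⟩ := hz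
  have e := (Homeomorph.addRight (fun i => (z i : ℝ))).preimage_interior (⋃ a, R a)
  exact ⟨_, e.ge hx⟩

/-- For every `s` in the torus some difference `j • s - i • s` with `i < j` is the image of an
arbitrarily short vector. -/
theorem exists_smul_eq_add_toTorus (s : Fin k → UnitAddCircle) {r : ℝ} (hr : 0 < r) :
    ∃ i j : ℕ, i < j ∧ ∃ ε : Fin k → ℝ, ‖ε‖ < r ∧ j • s = i • s + toTorus k ε := by
  obtain ⟨t, φ, hφ, hlim⟩ := CompactSpace.tendsto_subseq fun j : ℕ => j • s
  have hlim' : Filter.Tendsto (fun n => φ (n + 1) • s - φ n • s) Filter.atTop (nhds 0) := by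
    have := (hlim.comp (Filter.tendsto_add_atTop_nat 1)).sub hlim
    rwa [sub_self] at this
  have hnhds : toTorus k '' Metric.ball 0 r ∈ nhds (0 : Fin k → UnitAddCircle) :=
    (isOpenQuotientMap_toTorus.isOpenMap _ Metric.isOpen_ball).mem_nhds
      ⟨0, Metric.mem_ball_self hr, map_zero _⟩
  obtain ⟨n, ε, hε, hn⟩ := (hlim'.eventually hnhds).exists
  exact ⟨φ n, φ (n + 1), hφ (Nat.lt_succ_self n), ε, by simpa using hε, by rw [hn, add_sub_cancel]⟩

/-- If two regular orbits have the same coding, their lifts differ by a constant vector `c`, and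
density of orbits gives `U + c ⊆ U` for the interior `U` of the union of the sets `R a`. As `U`
embeds into the torus, recurrence of the rotation by `c` forces `c = 0`. No boundedness of the
sets `R a` is needed. -/
theorem code_injOn (h : IsExchangeTiling R δ α 𝓛) : InjOn h.code (regularOrbits R α) := by
  intro t ht t' ht' hcode
  set c := (h.lift t').1 - (h.lift t).1 with hc
  have hlift : ∀ j : ℕ, (h.lift (t' + j • α)).1 = (h.lift (t + j • α)).1 + c := by
    intro j
    rw [(h.code_spec ht j).2, (h.code_spec ht' j).2, hcode, hc]
    abel
  set U := interior (⋃ a, R a) with hU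
  have hsub : ∀ y ∈ U, y + c ∈ U := by
    have h1 : ∀ y ∈ U, y + c ∈ ⋃ a, R a := by
      by_contra! hex
      obtain ⟨y, hy, hyc⟩ := hex
      have hW : IsOpen (U ∩ (fun x => x + c) ⁻¹' (⋃ a, R a)ᶜ) :=
        isOpen_interior.inter
          (h.isClosed_iUnion.isOpen_compl.preimage (continuous_id.add continuous_const))
      obtain ⟨j, x, ⟨hx, hx'⟩, hxt⟩ := h.exists_add_mem_toTorus_image t hW ⟨y, hy, hyc⟩
      obtain ⟨a, ha⟩ := mem_iUnion.1 (interior_subset hx)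
      have hreg := ht j
      rw [natCast_zsmul] at hreg
      have e := h.lift_eq hreg hxt ha
      refine hx' (mem_iUnion.2 ⟨(h.lift (t' + j • α)).2, ?_⟩)
      have := h.lift_mem (t' + j • α)
      rwa [hlift, e] at this
    intro y hy
    have h2 : U ⊆ (Homeomorph.addRight c) ⁻¹' (⋃ a, R a) := fun y hy => h1 y hy
    have h3 := interior_maximal h2 isOpen_interior hy
    rwa [← (Homeomorph.addRight c).preimage_interior] at h3
  have hiter : ∀ j : ℕ, ∀ y ∈ U, y + j • c ∈ U := by
    intro j
    induction j with
    | zero => intro y hy; simpa using hy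
    | succ j ih =>
      intro y hy
      rw [succ_nsmul, ← add_assoc]
      exact hsub _ (ih y hy)
  have hc0 : c = 0 := by
    by_contra hne
    obtain ⟨y, hy⟩ := h.nonempty_interior
    obtain ⟨r, hr, hball⟩ := Metric.isOpen_iff.1 isOpen_interior y hy
    -- multiples of `J • c` are at distance more than `r` from each other, while some difference
    -- of two of them is congruent to a vector shorter than `r`
    obtain ⟨J, hJ⟩ := exists_nat_gt (r / ‖c‖)
    rw [div_lt_iff₀ (norm_pos_iff.2 hne)] at hJ
    obtain ⟨i, j, hij, ε, hε, he⟩ := exists_smul_eq_add_toTorus (toTorus k (J • c)) hr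
    have hyε : y + ε ∈ U := hball (by simpa using hε)
    have e := h.injOn_toTorus_interior ht (hiter (j * J) y hy) (hiter (i * J) _ hyε) (by
      simp only [map_add, map_nsmul, mul_smul] at he ⊢
      rw [he, add_comm (i • _), add_assoc])
    obtain ⟨m, rfl⟩ := Nat.exists_eq_add_of_lt hij
    have e2 : ε = ((m + 1) * J) • c := by
      have e3 : (i + m + 1) * J = (m + 1) * J + i * J := by ring
      rw [e3, add_smul, ← add_assoc, add_left_inj, add_right_inj] at e
      exact e.symm
    rw [e2, ← Nat.cast_smul_eq_nsmul ℝ, norm_smul, Real.norm_natCast] at hε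
    have : (J : ℝ) ≤ ((m + 1) * J : ℕ) := by
      exact_mod_cast Nat.le_mul_of_pos_left J (Nat.succ_pos m)
    nlinarith [norm_nonneg c]
  rw [← h.toTorus_lift t, ← h.toTorus_lift t', sub_eq_zero.1 (hc.symm.trans hc0)]

end IsExchangeTiling

/-! ### Transfer of the dynamics of the rotation -/

instance isProbabilityMeasure_volume_torus :
    IsProbabilityMeasure (volume : Measure (Fin k → UnitAddCircle)) := by
  have : IsProbabilityMeasure (volume : Measure UnitAddCircle) := ⟨by simp⟩
  infer_instance

theorem torusRotation_eq (α : Fin k → ℝ) (z : Fin k → UnitAddCircle) :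
    torusRotation α z = z + toTorus k α := rfl

/-- The characters of the torus are dense in `L²` for the Lebesgue measure. -/
theorem span_characters_closure_eq_top :
    (Submodule.span ℂ (range fun j : Fin k → ℤ =>
      ContinuousMap.toLp (E := ℂ) 2 (volume : Measure (Fin k → UnitAddCircle)) ℂ
        (UnitAddTorus.mFourier j))).topologicalClosure = ⊤ := by
  simpa only [Submodule.map_span, ContinuousLinearMap.coe_coe, ← range_comp, Function.comp_def]
    using (ContinuousMap.toLp_denseRange ℂ (volume : Measure (Fin k → UnitAddCircle)) ℂ
      (p := 2) (by simp)).topologicalClosure_map_submodule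
        UnitAddTorus.span_mFourier_closure_eq_top

theorem mFourier_apply_add (j : Fin k → ℤ) (x y : UnitAddTorus (Fin k)) :
    UnitAddTorus.mFourier j (x + y) = UnitAddTorus.mFourier j x * UnitAddTorus.mFourier j y := by
  simp [UnitAddTorus.mFourier, fourier_apply, smul_add, AddCircle.toCircle_add,
    Finset.prod_mul_distrib]

/-- A measurable injection, defined almost everywhere on the torus, that intertwines a rotation
with `T` carries Lebesgue measure to a `T`-invariant measure for which `T` is measurably conjugate
to the rotation.  The characters of the torus then become eigenfunctions of `T`. -/
theorem exists_conjugate_measure {X : Type*} [MeasurableSpace X]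
    [MeasurableSpace.CountablySeparated X] {T : X → X} (hT : Measurable T) (α : Fin k → ℝ)
    {G : Set (Fin k → UnitAddCircle)} (hG : MeasurableSet G) (hG0 : volume Gᶜ = 0)
    (hrot : MapsTo (torusRotation α) G G) {f : G → X} (hf : Measurable f)
    (hinj : Function.Injective f)
    (hfT : ∀ t : G, f ⟨torusRotation α t, hrot t.2⟩ = T (f t)) :
    ∃ μ : Measure X, IsProbabilityMeasure μ ∧ ∃ hμ : MeasurePreserving T μ μ,
      MeasurablyConjugate T μ (torusRotation α) volume ∧
      (⨆ c : ℂ, Module.End.eigenspace (koopman hμ) c).topologicalClosure = ⊤ := by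
  have hsb : StandardBorelSpace G := hG.standardBorel
  have hemb : MeasurableEmbedding f := hf.measurableEmbedding hinj
  have hval : MeasurableEmbedding (Subtype.val : G → Fin k → UnitAddCircle) :=
    MeasurableEmbedding.subtype_coe hG
  have hGae : ∀ᵐ t ∂(volume : Measure (Fin k → UnitAddCircle)), t ∈ G := hG0
  have hG1 : volume G = 1 := (prob_compl_eq_zero_iff hG).1 hG0
  obtain ⟨t₀, ht₀⟩ : G.Nonempty := nonempty_of_measure_ne_zero (by rw [hG1]; exact one_ne_zero)
  -- measurable extensions of `f` to the torus and of its inverse to `X`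
  obtain ⟨F, hFm, hF⟩ := hval.exists_measurable_extend hf fun _ => ⟨f ⟨t₀, ht₀⟩⟩
  obtain ⟨H, hHm, hH⟩ := hemb.exists_measurable_extend measurable_subtype_coe fun _ => ⟨t₀⟩
  have hF' : ∀ t : G, F t = f t := fun t => congrFun hF t
  have hH' : ∀ t : G, H (f t) = t := fun t => congrFun hH t
  set μ : Measure X := Measure.map F volume with hμdef
  have hFmp : MeasurePreserving F volume μ := ⟨hFm, rfl⟩
  have hrange : ∀ᵐ x ∂μ, x ∈ range f := by
    rw [hμdef]
    refine (ae_map_iff hFm.aemeasurable hemb.measurableSet_range).2 ?_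
    filter_upwards [hGae] with t ht
    exact ⟨⟨t, ht⟩, (hF' ⟨t, ht⟩).symm⟩
  have hrotm : MeasurePreserving (torusRotation α) volume volume :=
    measurePreserving_add_right volume (toTorus k α)
  have hprob : IsProbabilityMeasure μ := Measure.isProbabilityMeasure_map hFm.aemeasurable
  have hFT : F ∘ torusRotation α =ᵐ[volume] T ∘ F := by
    filter_upwards [hGae] with t ht
    have h1 := hF' ⟨torusRotation α t, hrot ht⟩
    have h2 := hF' ⟨t, ht⟩
    simp only [Function.comp_apply]
    rw [h1, h2]
    exact hfT ⟨t, ht⟩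
  have hμT : MeasurePreserving T μ μ := by
    refine ⟨hT, ?_⟩
    rw [hμdef, Measure.map_map hT hFm, ← Measure.map_congr hFT,
      ← Measure.map_map hFm hrotm.measurable, hrotm.map_eq]
  have hHmp : MeasurePreserving H μ volume := by
    refine ⟨hHm, ?_⟩
    rw [hμdef, Measure.map_map hHm hFm]
    have : H ∘ F =ᵐ[volume] id := by
      filter_upwards [hGae] with t ht
      have h2 := hF' ⟨t, ht⟩
      simp only [Function.comp_apply, id_eq]
      rw [h2]
      exact hH' ⟨t, ht⟩
    rw [Measure.map_congr this, Measure.map_id]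
  refine ⟨μ, hprob, hμT, ?_, ?_⟩
  · have hTmaps : MapsTo T (range f) (range f) := by
      rintro _ ⟨t, rfl⟩
      exact ⟨_, hfT t⟩
    refine ⟨range f, G, hemb.measurableSet_range, hG,
      (prob_compl_eq_zero_iff hemb.measurableSet_range).1 hrange, hG1, hTmaps,
      hemb.equivRange.symm, ?_, ?_⟩
    · rintro ⟨_, t, rfl⟩
      have e1 : hemb.equivRange.symm ⟨f t, t, rfl⟩ = t := by
        rw [MeasurableEquiv.symm_apply_eq]
        exact Subtype.ext (by simp [MeasurableEmbedding.equivRange_apply])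
      have e2 : hemb.equivRange.symm ⟨T (f t), hTmaps ⟨t, rfl⟩⟩ =
          ⟨torusRotation α t, hrot t.2⟩ := by
        rw [MeasurableEquiv.symm_apply_eq]
        exact Subtype.ext (by simp [MeasurableEmbedding.equivRange_apply, hfT])
      rw [e1, e2]
    · intro U hU
      have hUm : MeasurableSet ((fun x : range f => (x : X)) '' U) :=
        (MeasurableEmbedding.subtype_coe hemb.measurableSet_range).measurableSet_image.2 hU
      rw [← hFmp.measure_preimage hUm.nullMeasurableSet]
      refine measure_congr ?_
      filter_upwards [hGae] with t ht
      refine propext ⟨?_, ?_⟩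
      · rintro ⟨_, ⟨x, hx, rfl⟩, rfl⟩
        refine ⟨x, hx, ?_⟩
        rw [hF']
        have := congrArg Subtype.val (hemb.equivRange.apply_symm_apply x)
        rw [MeasurableEmbedding.equivRange_apply] at this
        exact this.symm
      · rintro ⟨x, hx, hxt⟩
        refine ⟨⟨t, ht⟩, ⟨x, hx, ?_⟩, rfl⟩
        rw [MeasurableEquiv.symm_apply_eq]
        refine Subtype.ext ?_
        have h2 := hF' ⟨t, ht⟩
        simp only at hxt
        rw [hxt, h2]
        simp [MeasurableEmbedding.equivRange_apply]
  · set E := ⨆ c : ℂ, Module.End.eigenspace (koopman hμT) c with hE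
    let Φ : Lp ℂ 2 (volume : Measure (Fin k → UnitAddCircle)) →ₗᵢ[ℂ] Lp ℂ 2 μ :=
      Lp.compMeasurePreservingₗᵢ ℂ H hHmp
    have hΦ : ∀ φ, Φ φ =ᵐ[μ] φ ∘ H := fun φ => Lp.coeFn_compMeasurePreserving φ hHmp
    have hsurj : ∀ g : Lp ℂ 2 μ, ∃ φ, Φ φ = g := by
      intro g
      refine ⟨Lp.compMeasurePreserving F hFmp g, Lp.ext ?_⟩
      refine (hΦ _).trans ?_
      have h1 := hHmp.quasiMeasurePreserving.ae_eq_comp (Lp.coeFn_compMeasurePreserving g hFmp)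
      refine h1.trans ?_
      filter_upwards [hrange] with x hx
      obtain ⟨t, rfl⟩ := hx
      simp only [Function.comp_apply, hH', hF']
    have hchar : ∀ j : Fin k → ℤ,
        Φ (ContinuousMap.toLp (E := ℂ) 2 (volume : Measure (Fin k → UnitAddCircle)) ℂ
          (UnitAddTorus.mFourier j)) ∈ E := by
      intro j
      set e := ContinuousMap.toLp (E := ℂ) 2 (volume : Measure (Fin k → UnitAddCircle)) ℂ
          (UnitAddTorus.mFourier j) with he
      have hee : Φ e =ᵐ[μ] fun x => UnitAddTorus.mFourier j (H x) := (hΦ e).trans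
        (hHmp.quasiMeasurePreserving.ae_eq_comp (ContinuousMap.coeFn_toLp volume _))
      refine Submodule.mem_iSup_of_mem (UnitAddTorus.mFourier j (toTorus k α)) ?_
      rw [Module.End.mem_eigenspace_iff]
      refine Lp.ext ?_
      have h1 : koopman hμT (Φ e) =ᵐ[μ] Φ e ∘ T := Lp.coeFn_compMeasurePreserving _ hμT
      refine h1.trans ((hμT.quasiMeasurePreserving.ae_eq_comp hee).trans ?_)
      filter_upwards [hrange, hee, Lp.coeFn_smul (UnitAddTorus.mFourier j (toTorus k α)) (Φ e)]
        with x hx h2 h3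
      rw [h3, Pi.smul_apply, h2, smul_eq_mul]
      obtain ⟨t, rfl⟩ := hx
      have h4 := hH' ⟨torusRotation α t, hrot t.2⟩
      simp only [Function.comp_apply]
      rw [← hfT, h4, hH', mul_comm]
      exact mFourier_apply_add _ _ _
    rw [eq_top_iff]
    rintro g -
    obtain ⟨φ, rfl⟩ := hsurj g
    have hφ : φ ∈ closure (Submodule.span ℂ (range fun j : Fin k → ℤ =>
        ContinuousMap.toLp (E := ℂ) 2 (volume : Measure (Fin k → UnitAddCircle)) ℂ
          (UnitAddTorus.mFourier j)) : Set (Lp ℂ 2 volume)) := by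
      rw [← Submodule.topologicalClosure_coe, span_characters_closure_eq_top]
      trivial
    refine map_mem_closure Φ.continuous hφ fun ψ hψ => ?_
    have hle : Submodule.span ℂ (range fun j : Fin k → ℤ =>
        ContinuousMap.toLp (E := ℂ) 2 (volume : Measure (Fin k → UnitAddCircle)) ℂ
          (UnitAddTorus.mFourier j)) ≤ E.comap Φ.toLinearMap :=
      Submodule.span_le.2 (by rintro _ ⟨j, rfl⟩; exact hchar j)
    exact hle hψ

/-! ### Coordinates on the hyperplane -/

/-- The parametrization of `𝟏^⊥` by `ℝ^k` whose inverse drops the last coordinate and changes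
sign.  With this sign, translation by the projection of a basis vector becomes, modulo `ℤ^k`,
translation by the frequency vector itself. -/
def hyperplaneParam (k : ℕ) : (Fin k → ℝ) →ₗ[ℝ] (Fin (k + 1) → ℝ) where
  toFun y := Fin.snoc (α := fun _ => ℝ) (fun i => -y i) (∑ i, y i)
  map_add' x y := by
    ext j
    refine Fin.lastCases ?_ (fun i => ?_) j
    · simp [Finset.sum_add_distrib]
    · simp [add_comm]
  map_smul' c y := by
    ext j
    refine Fin.lastCases ?_ (fun i => ?_) j
    · simp [Finset.mul_sum]
    · simp

/-- The negatives of the first `k` coordinates. -/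
def hyperplaneCoord (k : ℕ) : (Fin (k + 1) → ℝ) →ₗ[ℝ] (Fin k → ℝ) where
  toFun x i := -x i.castSucc
  map_add' x y := by ext i; simp [add_comm]
  map_smul' c x := by ext i; simp

theorem hyperplaneParam_castSucc (y : Fin k → ℝ) (i : Fin k) :
    hyperplaneParam k y i.castSucc = -y i := by simp [hyperplaneParam]

theorem hyperplaneParam_last (y : Fin k → ℝ) :
    hyperplaneParam k y (Fin.last k) = ∑ i, y i := by simp [hyperplaneParam]

theorem hyperplaneCoord_apply (x : Fin (k + 1) → ℝ) (i : Fin k) :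
    hyperplaneCoord k x i = -x i.castSucc := rfl

theorem mem_hyperplane_one {x : Fin d → ℝ} :
    x ∈ hyperplane (1 : Fin d → ℝ) ↔ ∑ i, x i = 0 := by
  change x ⬝ᵥ 1 = 0 ↔ _
  rw [dotProduct_one]

theorem hyperplaneParam_mem (y : Fin k → ℝ) :
    hyperplaneParam k y ∈ hyperplane (1 : Fin (k + 1) → ℝ) := by
  rw [mem_hyperplane_one, Fin.sum_univ_castSucc]
  simp [hyperplaneParam_castSucc, hyperplaneParam_last]

theorem hyperplaneCoord_param (y : Fin k → ℝ) : hyperplaneCoord k (hyperplaneParam k y) = y := by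
  ext i
  rw [hyperplaneCoord_apply, hyperplaneParam_castSucc, neg_neg]

theorem hyperplaneParam_coord {x : Fin (k + 1) → ℝ}
    (hx : x ∈ hyperplane (1 : Fin (k + 1) → ℝ)) :
    hyperplaneParam k (hyperplaneCoord k x) = x := by
  rw [mem_hyperplane_one, Fin.sum_univ_castSucc] at hx
  ext j
  refine Fin.lastCases ?_ (fun i => ?_) j
  · rw [hyperplaneParam_last]
    simp only [hyperplaneCoord_apply, Finset.sum_neg_distrib]
    linarith
  · rw [hyperplaneParam_castSucc, hyperplaneCoord_apply, neg_neg]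

theorem continuous_hyperplaneParam : Continuous (hyperplaneParam k) :=
  (hyperplaneParam k).continuous_of_finiteDimensional

theorem continuous_hyperplaneCoord : Continuous (hyperplaneCoord k) :=
  (hyperplaneCoord k).continuous_of_finiteDimensional

/-- The parametrization as an isomorphism onto the hyperplane. -/
noncomputable def hyperplaneEquiv (k : ℕ) :
    (Fin k → ℝ) ≃L[ℝ] hyperplane (1 : Fin (k + 1) → ℝ) :=
  LinearEquiv.toContinuousLinearEquiv
    { (hyperplaneParam k).codRestrict _ hyperplaneParam_mem with
      invFun := fun x => hyperplaneCoord k x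
      left_inv := hyperplaneCoord_param
      right_inv := fun x => Subtype.ext (hyperplaneParam_coord x.2) }

theorem volume_preimage_hyperplaneParam_eq_zero {s : Set (Fin (k + 1) → ℝ)}
    (h : (Measure.addHaar : Measure (hyperplane (1 : Fin (k + 1) → ℝ)))
      ((fun z : hyperplane (1 : Fin (k + 1) → ℝ) => (z : Fin (k + 1) → ℝ)) ⁻¹' s) = 0) :
    volume (hyperplaneParam k ⁻¹' s) = 0 := by
  have h2 : Measure.map (hyperplaneEquiv k) (volume : Measure (Fin k → ℝ))
      ((fun z : hyperplane (1 : Fin (k + 1) → ℝ) => (z : Fin (k + 1) → ℝ)) ⁻¹' s) = 0 :=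
    Measure.absolutelyContinuous_isAddHaarMeasure _ _ h
  have h3 := (hyperplaneEquiv k).toHomeomorph.toMeasurableEquiv.map_apply
    (μ := (volume : Measure (Fin k → ℝ)))
    ((fun z : hyperplane (1 : Fin (k + 1) → ℝ) => (z : Fin (k + 1) → ℝ)) ⁻¹' s)
  exact h3.symm.trans h2

theorem proj_add (v w x y : Fin d → ℝ) : proj v w (x + y) = proj v w x + proj v w y := by
  simp only [proj, add_dotProduct, add_div, add_smul]
  abel

theorem proj_mem_hyperplane {v : Fin d → ℝ} (hv : ∑ i, v i ≠ 0) (x : Fin d → ℝ) :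
    proj v 1 x ∈ hyperplane (1 : Fin d → ℝ) := by
  change proj v 1 x ⬝ᵥ 1 = 0
  have : v ⬝ᵥ (1 : Fin d → ℝ) ≠ 0 := by rwa [dotProduct_one]
  rw [proj, sub_dotProduct, smul_dotProduct, smul_eq_mul, div_mul_cancel₀ _ this, sub_self]

theorem proj_eq_self (v : Fin d → ℝ) {x : Fin d → ℝ}
    (hx : x ∈ hyperplane (1 : Fin d → ℝ)) : proj v 1 x = x := by
  have hx' : x ⬝ᵥ 1 = 0 := hx
  simp [proj, hx']

theorem toTorus_coord_intCast (z : Fin (k + 1) → ℤ) :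
    toTorus k (hyperplaneCoord k fun i => (z i : ℝ)) = 0 :=
  toTorus_eq_zero_iff.2 ⟨fun i => -z i.castSucc, by ext i; simp [hyperplaneCoord_apply]⟩

theorem toTorus_coord_proj (v : Fin (k + 1) → ℝ) (p : List (Fin (k + 1))) :
    toTorus k (hyperplaneCoord k (proj v 1 (abelianization p))) =
      p.length • toTorus k fun i => normalize v i.castSucc := by
  rw [← map_nsmul, toTorus_eq_iff]
  refine ⟨fun i => -(p.count i.castSucc : ℤ), ?_⟩
  ext i
  rw [hyperplaneCoord_apply, proj, dotProduct_one, dotProduct_one, sum_abelianization]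
  simp [normalize, abelianization, div_eq_mul_inv]
  ring

/-! ### Words and subtiles -/

/-- The words `p` such that `p w` is a prefix of `σ_{[n,m)}(b)` for infinitely many `m` and some
letter `b`. -/
def limitPrefixes (σ : ℤ → Monoid.End (FreeMonoid (Fin d))) (n : ℤ) (w : List (Fin d)) :
    Set (List (Fin d)) :=
  {p | {m : ℤ | n ≤ m ∧ ∃ b : Fin d,
      (p ++ w) <+: FreeMonoid.toList (segProd σ n m (FreeMonoid.of b))}.Infinite}

theorem subtile_eq (σ : ℤ → Monoid.End (FreeMonoid (Fin d))) (v w : Fin d → ℝ) (n : ℤ)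
    (a : Fin d) : subtile σ v w n a =
      closure ((fun p => proj v w (abelianization p)) '' limitPrefixes σ n [a]) := by
  rw [subtile]
  congr 1
  ext x
  constructor
  · rintro ⟨p, rfl, hp⟩; exact ⟨p, hp, rfl⟩
  · rintro ⟨p, hp, rfl⟩; exact ⟨p, rfl, hp⟩

theorem append_mem_limitPrefixes {σ : ℤ → Monoid.End (FreeMonoid (Fin d))} {n : ℤ}
    {p x y : List (Fin d)} {a : Fin d} (hp : p ∈ limitPrefixes σ n (x ++ a :: y)) :
    p ++ x ∈ limitPrefixes σ n [a] := by
  refine Set.Infinite.mono ?_ hp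
  rintro m ⟨hm, b, hb⟩
  exact ⟨hm, b, List.IsPrefix.trans ⟨y, by simp⟩ hb⟩

theorem mem_language_of_mem_limitPrefixes {σ : ℤ → Monoid.End (FreeMonoid (Fin d))}
    {n : ℤ} {p w : List (Fin d)} (hp : p ∈ limitPrefixes σ n w) : w ∈ language σ n := by
  obtain ⟨m, ⟨hm, b, hb⟩, hne⟩ := hp.exists_notMem_finite (finite_singleton n)
  exact ⟨b, m, lt_of_le_of_ne hm fun e => hne e.symm,
    (List.infix_append_right).trans hb.isInfix⟩

/-- As images of letters grow, each limit prefix before `a` is a limit prefix before some longer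
word beginning with `a`; the number of candidates is finite. -/
theorem exists_mem_limitPrefixes (hd : 2 ≤ d)
    {σ : ℤ → Monoid.End (FreeMonoid (Fin d))}
    (hσ : ∀ k, σ k ∈ unimodularSubstitutions d) (hprim : IsPrimitiveSeq (incidenceSeq σ))
    (n : ℤ) (N : ℕ) {p : List (Fin d)} {a : Fin d} (hp : p ∈ limitPrefixes σ n [a]) :
    ∃ r : List (Fin d), r.length = N ∧ p ∈ limitPrefixes σ n (a :: r) := by
  by_contra! hcon
  obtain ⟨m₀, -, hm₀⟩ := exists_le_length_segProd hd hσ hprim n (p.length + 1 + N)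
  have hfin : (⋃ r ∈ {r : List (Fin d) | r.length = N}, {m : ℤ | n ≤ m ∧ ∃ b : Fin d,
      (p ++ a :: r) <+: FreeMonoid.toList (segProd σ n m (FreeMonoid.of b))}).Finite :=
    (List.finite_length_eq (Fin d) N).biUnion fun r hr => not_infinite.1 (hcon r hr)
  refine hp (((finite_Ico n m₀).union hfin).subset ?_)
  rintro m ⟨hm, b, s, hs⟩
  rcases lt_or_ge m m₀ with hlt | hge
  · exact Or.inl ⟨hm, hlt⟩
  · right
    have hlen := hm₀ m hge b
    rw [applyWord_singleton, ← hs] at hlen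
    simp only [List.length_append, List.length_singleton] at hlen
    refine mem_biUnion (x := s.take N) (by simp; omega) ⟨hm, b, s.drop N, ?_⟩
    rw [← hs]
    simp

/-- From a point of a subtile one can walk `N` steps inside the subtiles, along a word of the
language: the point is a limit of prefixes that all continue with the same word. -/
theorem exists_word_of_mem_subtile (hd : 2 ≤ d)
    {σ : ℤ → Monoid.End (FreeMonoid (Fin d))}
    (hσ : ∀ k, σ k ∈ unimodularSubstitutions d) (hprim : IsPrimitiveSeq (incidenceSeq σ))
    (v w : Fin d → ℝ) (n : ℤ) {a : Fin d} {x : Fin d → ℝ} (hx : x ∈ subtile σ v w n a) (N : ℕ) :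
    ∃ f : ℕ → Fin d, f 0 = a ∧
      (∀ j ≤ N, x + ∑ i ∈ Finset.range j, proj v w (abelianization [f i]) ∈
        subtile σ v w n (f j)) ∧ (List.range N).map f ∈ language σ n := by
  rw [subtile_eq] at hx
  have hsub : (fun p => proj v w (abelianization p)) '' limitPrefixes σ n [a] ⊆
      ⋃ r ∈ {r : List (Fin d) | r.length = N},
        (fun p => proj v w (abelianization p)) '' limitPrefixes σ n (a :: r) := by
    rintro _ ⟨p, hp, rfl⟩
    obtain ⟨r, hr, hpr⟩ := exists_mem_limitPrefixes hd hσ hprim n N hp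
    exact mem_biUnion (x := r) hr ⟨p, hpr, rfl⟩
  have hx' := closure_mono hsub hx
  rw [(List.finite_length_eq (Fin d) N).closure_biUnion] at hx'
  obtain ⟨r, hr, hxr⟩ := mem_iUnion₂.1 hx'
  have hr' : (a :: r).length = N + 1 := by rw [List.length_cons, hr]
  let f : ℕ → Fin d := fun j => (a :: r).getD j a
  have hf : ∀ j ≤ N + 1, (List.range j).map f = (a :: r).take j := by
    intro j hj
    refine List.ext_getElem (by simp at hr' ⊢; omega) fun i h1 h2 => ?_
    simp only [List.length_map, List.length_range] at h1
    have hi : i < (a :: r).length := by omega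
    simp only [List.getElem_map, List.getElem_range, List.getElem_take, f]
    exact List.getD_eq_getElem _ _ hi
  have hsum : ∀ j, ∑ i ∈ Finset.range j, proj v w (abelianization [f i]) =
      proj v w (abelianization ((List.range j).map f)) := by
    intro j
    induction j with
    | zero => simp [abelianization_nil, proj]
    | succ j ih =>
      rw [Finset.sum_range_succ, ih, List.range_succ, List.map_append, abelianization_append,
        proj_add]
      rfl
  refine ⟨f, rfl, fun j hj => ?_, ?_⟩
  · rw [subtile_eq, hsum]
    refine map_mem_closure (f := (· + proj v w (abelianization ((List.range j).map f))))
      (continuous_id.add continuous_const) hxr ?_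
    rintro _ ⟨p, hp, rfl⟩
    refine ⟨p ++ (List.range j).map f, ?_, ?_⟩
    · have hlt : j < (a :: r).length := by omega
      have e : a :: r = (List.range j).map f ++ f j :: (a :: r).drop (j + 1) := by
        rw [hf j (by omega)]
        have : f j = (a :: r)[j] := List.getD_eq_getElem _ _ hlt
        rw [this, List.cons_getElem_drop_succ, List.take_append_drop]
      rw [e] at hp
      exact append_mem_limitPrefixes hp
    · simp only [abelianization_append, proj_add]
  · rw [hf N (by omega)]
    obtain ⟨_, p, hp, rfl⟩ := closure_nonempty_iff.1 ⟨x, hxr⟩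
    obtain ⟨b, m, hm, hw⟩ := mem_language_of_mem_limitPrefixes hp
    exact ⟨b, m, hm, (List.take_prefix _ _).isInfix.trans hw⟩

/-! ### From the tiling of the hyperplane to the rotation of the torus -/

/-- In coordinates, a tiling by subtiles is an exchange tiling for the rotation by the vector of
letter frequencies. -/
theorem isExchangeTiling_subtile (hk : 2 ≤ k + 1)
    {σ : ℤ → Monoid.End (FreeMonoid (Fin (k + 1)))}
    (hσ : ∀ j, σ j ∈ unimodularSubstitutions (k + 1)) (hprim : IsPrimitiveSeq (incidenceSeq σ))
    {v : Fin (k + 1) → ℝ} (hv : ∑ i, v i ≠ 0) {n : ℤ}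
    (htile : IsTilingOfHyperplane (1 : Fin (k + 1) → ℝ) (tile σ v (1 : Fin (k + 1) → ℝ) n)) :
    IsExchangeTiling (fun a => hyperplaneParam k ⁻¹' subtile σ v 1 n a)
      (fun a => hyperplaneCoord k (proj v 1 (abelianization [a])))
      (toTorus k fun i => normalize v i.castSucc) (language σ n) := by
  have hcov : ∀ t, ∃ q : (Fin k → ℝ) × Fin (k + 1), toTorus k q.1 = t ∧
      q.1 ∈ hyperplaneParam k ⁻¹' subtile σ v 1 n q.2 := by
    intro t
    obtain ⟨y, rfl⟩ := isOpenQuotientMap_toTorus.surjective t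
    have hy : hyperplaneParam k y ∈ (hyperplane (1 : Fin (k + 1) → ℝ) : Set _) :=
      hyperplaneParam_mem y
    rw [← htile.covers, mem_iUnion] at hy
    obtain ⟨⟨⟨z, a⟩, hq⟩, x, hx, hxy⟩ := hy
    have hz : (fun i => (z i : ℝ)) ∈ hyperplane (1 : Fin (k + 1) → ℝ) := by
      rw [mem_hyperplane_one]
      simp only [discreteHyperplane, mem_ofPred_eq, one_dotProduct, Pi.one_apply] at hq
      obtain ⟨h0, h1⟩ := hq
      have h2 : (0 : ℤ) ≤ ∑ i, z i := by exact_mod_cast h0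
      have h3 : ∑ i, z i < 1 := by exact_mod_cast h1
      have h4 : ∑ i, z i = 0 := by omega
      exact_mod_cast h4
    simp only [proj_eq_self v hz] at hxy
    refine ⟨(y - hyperplaneCoord k fun i => (z i : ℝ), a), ?_, ?_⟩
    · simp only [map_sub, toTorus_coord_intCast, sub_zero]
    · simp only [mem_preimage, map_sub, hyperplaneParam_coord hz, ← hxy, add_sub_cancel_left]
      exact hx
  refine ⟨fun a => isClosed_closure.preimage continuous_hyperplaneParam, hcov, ?_, ?_, ?_, ?_⟩
  · intro a a' z hne
    -- the integer point of the hyperplane whose tile becomes the translate of `R a'` by `-z`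
    let Z : Fin (k + 1) → ℤ := Fin.snoc (α := fun _ => ℤ) z (-∑ i, z i)
    have hZ : (fun i => (Z i : ℝ)) = -hyperplaneParam k fun i => (z i : ℝ) := by
      ext j
      refine Fin.lastCases ?_ (fun i => ?_) j
      · simp [Z, hyperplaneParam_last]
      · simp [Z, hyperplaneParam_castSucc]
    have hZmem : (fun i => (Z i : ℝ)) ∈ hyperplane (1 : Fin (k + 1) → ℝ) := by
      rw [hZ]; exact Submodule.neg_mem _ (hyperplaneParam_mem _)
    have h0 : ((0 : Fin (k + 1) → ℤ), a) ∈ discreteHyperplane (1 : Fin (k + 1) → ℝ) := by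
      simp [discreteHyperplane]
    have h1 : (Z, a') ∈ discreteHyperplane (1 : Fin (k + 1) → ℝ) := by
      rw [mem_hyperplane_one] at hZmem
      simp [discreteHyperplane, one_dotProduct, hZmem]
    have hdist : (⟨_, h0⟩ : discreteHyperplane (1 : Fin (k + 1) → ℝ)) ≠ ⟨_, h1⟩ := by
      intro e
      obtain ⟨e1, e2⟩ := Prod.mk.inj (Subtype.mk.inj e)
      refine hne (Prod.ext ?_ e2.symm)
      ext i
      have := congrFun e1 i.castSucc
      simpa [Z] using this.symm
    refine measure_mono_null ?_
      (volume_preimage_hyperplaneParam_eq_zero (htile.disjoint_in_measure _ _ hdist))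
    rintro x ⟨hx, hx'⟩
    refine ⟨⟨hyperplaneParam k x, hx, ?_⟩, ⟨hyperplaneParam k (x + fun i => (z i : ℝ)), hx', ?_⟩⟩
    · have e : (fun i => (((0 : Fin (k + 1) → ℤ) i : ℤ) : ℝ)) = 0 := by ext i; simp
      simp only [e, proj_eq_self v (Submodule.zero_mem _), zero_add]
    · simp only [proj_eq_self v hZmem]
      rw [hZ, map_add, add_comm (hyperplaneParam k x), neg_add_cancel_left]
  · intro a
    rw [toTorus_coord_proj, List.length_singleton, one_smul]
  · intro a x hx N
    obtain ⟨f, hf0, hf, hfL⟩ := exists_word_of_mem_subtile hk hσ hprim v 1 n hx N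
    refine ⟨f, hf0, fun j hj => ?_, hfL⟩
    simpa [hyperplaneParam_coord (proj_mem_hyperplane hv _)] using hf j hj
  · intro t
    obtain ⟨⟨x, a⟩, rfl, hx⟩ := hcov t
    rw [mem_preimage, subtile_eq] at hx
    have h := map_mem_closure (t := range fun j : ℕ => j • toTorus k fun i => normalize v i.castSucc)
      (continuous_toTorus.comp continuous_hyperplaneCoord) hx (by
        rintro _ ⟨p, -, rfl⟩
        exact ⟨p.length, (toTorus_coord_proj v p).symm⟩)
    simpa [hyperplaneCoord_param] using h

theorem isMinimalMap_torusRotation {α : Fin k → ℝ}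
    (h : ∀ t, t ∈ closure (range fun j : ℕ => j • toTorus k α)) :
    IsMinimalMap (torusRotation α) := by
  intro S hS hmaps
  refine S.eq_empty_or_nonempty.imp_right fun ⟨z, hz⟩ => eq_univ_of_forall fun t => ?_
  have hiter : ∀ j : ℕ, z + j • toTorus k α ∈ S := by
    intro j
    induction j with
    | zero => simpa using hz
    | succ j ih =>
      have := hmaps ih
      rwa [torusRotation_eq, add_assoc, ← succ_nsmul] at this
  rw [← hS.closure_eq]
  have := map_mem_closure (t := S) (continuous_const.add continuous_id : Continuous (z + ·))
    (h (t - z)) (by rintro _ ⟨j, rfl⟩; exact hiter j)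
  simpa using this

theorem completedVector_normalize_mem_ray {v : Fin (k + 1) → ℝ} (hv0 : 0 < ∑ i, v i) :
    completedVector (d := k + 1) (fun i : Fin k => normalize v i.castSucc) ∈ ray v := by
  refine ⟨(∑ i, v i)⁻¹, by positivity, ?_⟩
  change _ = normalize v
  ext j
  refine Fin.lastCases ?_ (fun i => ?_) j
  · have h1 := sum_normalize hv0.ne'
    rw [Fin.sum_univ_castSucc] at h1
    rw [completedVector, dif_neg (by simp)]
    exact sub_eq_of_eq_add' h1.symm
  · rw [completedVector, dif_pos (by simp)]
    rfl

end SAdic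

theorem mainTheorem7 {d : ℕ} (hd : 2 ≤ d)
    (σ : ℤ → Monoid.End (FreeMonoid (Fin d)))
    (hσ : ∀ k, σ k ∈ unimodularSubstitutions d)
    (hprim : IsPrimitiveSeq (incidenceSeq σ))
    (u : Fin d → ℝ) (hu : IsGeneralizedRightEigenvector (incidenceSeq σ) u)
    (n : ℤ)
    (htile : IsTilingOfHyperplane (1 : Fin d → ℝ)
      (tile σ (levelVector (incidenceSeq σ) u n) (1 : Fin d → ℝ) n)) :
    ∃ μ : MeasureTheory.Measure (shiftSpace σ n),
      IsUniqueInvariantProbability (shiftMap σ n) μ ∧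
      (∃ α : Fin (d - 1) → ℝ,
        completedVector α ∈ ray (levelVector (incidenceSeq σ) u n) ∧
        IsMinimalMap (torusRotation α) ∧
        MeasurablyConjugate (shiftMap σ n) μ (torusRotation α) MeasureTheory.volume) ∧
      HasPureDiscreteSpectrum (shiftMap σ n) := by
  obtain ⟨k, rfl⟩ : ∃ k, d = k + 1 := ⟨d - 1, by omega⟩
  obtain ⟨hv0, hvne, hcone⟩ := levelVector_spans_cone hσ hu n
  set v := levelVector (incidenceSeq σ) u n with hv
  have hvpos := sum_pos_of_nonneg hv0 hvne
  have h := isExchangeTiling_subtile hd hσ hprim hvpos.ne' htile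
  set α : Fin k → ℝ := fun i => normalize v i.castSucc with hα
  let f : regularOrbits (fun a => hyperplaneParam k ⁻¹' subtile σ v 1 n a) (toTorus k α) →
      shiftSpace σ n := fun t => ⟨h.code t, fun i N => h.factor_code_mem t.2 i N⟩
  have hrot : MapsTo (torusRotation α)
      (regularOrbits (fun a => hyperplaneParam k ⁻¹' subtile σ v 1 n a) (toTorus k α))
      (regularOrbits (fun a => hyperplaneParam k ⁻¹' subtile σ v 1 n a) (toTorus k α)) := by
    intro t ht
    have := IsExchangeTiling.add_mem_regularOrbits ht 1
    rwa [one_smul] at this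
  obtain ⟨μ, hμ, hμT, hconj, hspec⟩ := exists_conjugate_measure (measurable_shiftMap σ n) α
    h.measurableSet_regularOrbits h.volume_compl_regularOrbits hrot (f := f)
    (h.measurable_code.subtype_mk)
    (fun t t' e => Subtype.ext (h.code_injOn t.2 t'.2 (congrArg Subtype.val e)))
    (fun t => Subtype.ext (funext fun j => by
      have := h.code_add t 1 j
      rw [one_smul, add_comm 1 j] at this
      exact this))
  have huniq : IsUniqueInvariantProbability (shiftMap σ n) μ :=
    ⟨hμ, hμT, fun ν hν hνT => measure_eq_of_invariant hd hσ hprim hcone hνT hμT⟩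
  exact ⟨μ, huniq, ⟨α, completedVector_normalize_mem_ray hvpos,
    isMinimalMap_torusRotation h.dense, hconj⟩, isMinimalMap_shiftMap hprim n, μ, huniq, hspec⟩
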